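/- **Setting.** Let $G\ge 1$, $d\ge 0$, let $Z$ be a set, $n_1,\dots,n_G\ge 1$, $n=\sum_g n_g$. A dataset is a family $D=(D_g)_{g\in[G]}$ with $D_g\in Z^{n_g}$; $D,D'$ are neighbouring in group $g$ if they are identical except for at most one element of $D_g$. For $\alpha>1$ let $D_\alpha(P\|Q)=\frac1{\alpha-1}\log\mathbb E_{o\sim Q}\big(\frac{dP}{dQ}(o)\big)^\alpha$ ($=\infty$ if $P\not\ll Q$). A randomized mechanism $\mathcal M$ has per-group $(\alpha,(\varepsilon_g)_g)$-RDP guarantees if $D_\alpha(\mathcal M(D)\|\mathcal M(D'))\le\varepsilon_g$ for every $g$ and all $D,D'$ neighbouring in group $g$; it is (uniformly) $(\alpha,\varepsilon)$-RDP if $D_\alpha(\mathcal M(D)\|\mathcal M(D'))\le\varepsilon$ for all $g$ and all $D,D'$ neighbouring in group $g$. Let $\operatorname{clip}(x,C)=x\min(C/\|x\|,1)$. **The functions $\varepsilon_\alpha(\gamma,\kappa)$.** The statement holds for both of the following. (a) For real $\alpha>1$: $\varepsilon_\alpha(\gamma,\kappa)$ is the smallest $\varepsilon\ge0$ such that for all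 dimensions $d'$, all dataset sizes $N$ and all $C>0$, $s=\kappa C$, the subsampled Gaussian mechanism $(x_1,\dots,x_N)\mapsto\sum_{i\in B}\operatorname{clip}(x_i,C)+\mathcal N(0,s^2I)$ on $(\mathbb R^{d'})^N$, with $B$ a uniformly random subset of $[N]$ of size $\lfloor\gamma N\rfloor$ (sampling without replacement), satisfies $D_\alpha\le\varepsilon$ for any two inputs that differ in at most one entry. (b) For integer $\alpha\ge2$: $$\varepsilon_\alpha(\gamma,\kappa)=\frac1{\alpha-1}\log\Big(1+\gamma^2\binom\alpha2\min\{4(e^{4/\kappa^2}-1),2e^{4/\kappa^2}\}+\sum_{j=3}^\alpha\gamma^j\binom\alpha j\,2\,e^{(j-1)2j/\kappa^2}\Big).$$ **The algorithm.** Let $\ell:Z\times\mathbb R^d\to\mathbb R$ be a loss with $\ell(z,\cdot)$ measurable for every $z$ (with $\nabla\ell$, the gradient in $\theta$, read as $0$ where it does not exist), $T\ge0$, $k\ge1$, $\xi,\sigma,\zeta,\tau>0$, $\gamma^\ell\in[0,1]$, learning rate $\eta\in\mathbb R$, loss temperature $\beta\in\mathbb R$, and batch sizes $m_g\le n_g$.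 Draw $\theta_1\in\mathbb R^d$ from a fixed distribution and put $\lambda_g=1/G$. For $t=1,\dots,T$: draw $g\sim\mathrm{Cat}(\lambda)$, draw a batch $B$ of size $m_g$ from $D_g$ uniformly without replacement, and set $$\theta_{t+1}=\theta_t-\frac{\eta}{m_g}\Big(\sum_{z\in B}\operatorname{clip}(\nabla\ell(z,\theta_t),\xi)+\mathcal N(0,\sigma^2I)\Big);$$ if $k\mid t$, then, independently for each $g\in[G]$, draw a batch $B_g^\ell$ of size $\lfloor\gamma^\ell n_g\rfloor$ from $D_g$ uniformly without replacement, let $L_g=\frac1{|B^\ell_g|}\big(\sum_{z\in B_g^\ell}\operatorname{clip}(\ell(z,\theta_t),\zeta)+\mathcal N(0,\tau^2)\big)$, and replace $\lambda$ by $\tilde\lambda/\|\tilde\lambda\|_1$ with $\tilde\lambda_g=\lambda_g e^{\beta L_g}$. (Here $1/0=0$, so empty batches cause no update.) The output is $\theta_{T+1}$. *aZB* is this algorithm with $m_g=M$ for all $g$, where $M\le\min_g n_g$; *aZB-weak* is the same algorithm with a different choice of the noise multiplier $\sigma/\xi$; *aZB-prop* has $m_g=\lfloor M n_g/n\rfloor$,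 where $M\le n$. **Proposition.** For all values of the parameters above: 1. aZB (and hence aZB-weak) has per-group RDP guarantees $(\alpha,(\varepsilon_g)_g)$ with $$\varepsilon_g=T\,\varepsilon_\alpha\Big(\frac M{n_g},\frac\sigma\xi\Big)+\Big\lfloor\frac Tk\Big\rfloor\,\varepsilon_\alpha\Big(\gamma^\ell,\frac\tau\zeta\Big),$$ and it is uniformly $(\alpha,\varepsilon)$-RDP with $$\varepsilon=\max_g\varepsilon_g=T\,\varepsilon_\alpha\Big(\frac M{\min_g n_g},\frac\sigma\xi\Big)+\Big\lfloor\frac Tk\Big\rfloor\,\varepsilon_\alpha\Big(\gamma^\ell,\frac\tau\zeta\Big).$$ 2. aZB-prop is uniformly $(\alpha,\varepsilon)$-RDP with $$\varepsilon=T\,\varepsilon_\alpha\Big(\frac M{n},\frac\sigma\xi\Big)+\Big\lfloor\frac Tk\Big\rfloor\,\varepsilon_\alpha\Big(\gamma^\ell,\frac\tau\zeta\Big).$$ -/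

import Mathlib

open MeasureTheory ProbabilityTheory
open scoped ENNReal

namespace PrivateDRO

noncomputable section

/-! ### Rényi differential privacy -/

/-- Rényi divergence of order `α > 1`:
`D_α(P ‖ Q) = (α - 1)⁻¹ * log E_{o ∼ Q} (dP/dQ (o)) ^ α`, and `∞` unless `P ≪ Q`. -/
def renyiDiv {Ω : Type*} [MeasurableSpace Ω] (α : ℝ) (P Q : Measure Ω) : EReal :=
  open Classical in
  if P ≪ Q then ((1 / (α - 1) : ℝ) : EReal) * ENNReal.log (∫⁻ o, (P.rnDeriv Q o) ^ α ∂Q) else ⊤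

/-- `(α, ε)`-RDP of the randomized mechanism `mech` (given by its output laws, which have to be
probability measures) with respect to the neighbouring relation `nbr`. -/
def IsRDP {X Ω : Type*} [MeasurableSpace Ω] (α : ℝ) (nbr : X → X → Prop) (mech : X → Measure Ω)
    (ε : ℝ) : Prop :=
  (∀ x, IsProbabilityMeasure (mech x)) ∧
    ∀ x x', nbr x x' → renyiDiv α (mech x) (mech x') ≤ (ε : EReal)

/-- The "replace one" relation for datasets of size `n`: equal except possibly at one index. -/
def ReplaceOne {Z : Type*} {n : ℕ} (x x' : Fin n → Z) : Prop :=
  ∃ i, ∀ j, j ≠ i → x j = x' j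

/-- A dataset split into `G` groups, of public sizes `n 0, …, n (G - 1)`. -/
abbrev GroupDataset {G : ℕ} (n : Fin G → ℕ) (Z : Type*) : Type _ := (g : Fin G) → Fin (n g) → Z

/-- Neighbouring grouped datasets whose differing element belongs to group `g`. -/
def NeighborsIn {Z : Type*} {G : ℕ} {n : Fin G → ℕ} (g : Fin G) (D D' : GroupDataset n Z) : Prop :=
  ReplaceOne (D g) (D' g) ∧ ∀ g', g' ≠ g → D g' = D' g'

/-- Per-group guarantees: the divergence is at most `ε g` whenever the differing element belongs
to group `g`. -/
def IsGroupRDP {Z Ω : Type*} [MeasurableSpace Ω] {G : ℕ} {n : Fin G → ℕ} (α : ℝ)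
    (mech : GroupDataset n Z → Measure Ω) (ε : Fin G → ℝ) : Prop :=
  ∀ g, IsRDP α (NeighborsIn g) mech (ε g)

/-- The uniform guarantee: the differing element may belong to any group. -/
def IsUniformRDP {Z Ω : Type*} [MeasurableSpace Ω] {G : ℕ} {n : Fin G → ℕ} (α : ℝ)
    (mech : GroupDataset n Z → Measure Ω) (ε : ℝ) : Prop :=
  IsRDP α (fun D D' => ∃ g, NeighborsIn g D D') mech ε

/-! ### The subsampled Gaussian mechanism -/

/-- `clip(x; C) = x * min(C / ‖x‖, 1)`. -/
def clip {E : Type*} [NormedAddCommGroup E] [NormedSpace ℝ E] (C : ℝ) (x : E) : E :=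
  min (C / ‖x‖) 1 • x

/-- Law of `∑ i ∈ B, clip(x i; C) + N(0, s² I)`, where the batch `B` is uniform among the subsets
of `m` of the `n` indices (sampling without replacement). -/
def subsampledGaussian {E : Type*} [NormedAddCommGroup E] [InnerProductSpace ℝ E]
    [FiniteDimensional ℝ E] [MeasurableSpace E] [BorelSpace E]
    {n : ℕ} (m : ℕ) (C s : ℝ) (x : Fin n → E) : Measure E :=
  ∑ B ∈ Finset.powersetCard m (Finset.univ : Finset (Fin n)),
    (n.choose m : ℝ≥0∞)⁻¹ • (stdGaussian E).map (fun w => (∑ i ∈ B, clip C (x i)) + s • w)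

/-- `ε_α(γ, κ)` as an optimal value: the smallest `ε` such that the subsampled Gaussian mechanism
with sampling rate `γ` (batches of size `⌊γ n⌋` out of `n`) and noise multiplier `κ = s / C` is
`(α, ε)`-RDP, whatever the dimension, the dataset size and the clipping threshold. -/
def sgmEps (α γ κ : ℝ) : ℝ :=
  sInf {ε : ℝ | 0 ≤ ε ∧ ∀ (d n : ℕ) (C s : ℝ), 0 < C → s / C = κ →
    IsRDP α (ReplaceOne (n := n))
      (subsampledGaussian (E := EuclideanSpace ℝ (Fin d)) ⌊γ * n⌋₊ C s) ε}

/-- RDP guarantee `α / (2 (κ / 2)²)` of the Gaussian mechanism without subsampling. -/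
def gaussEps (α κ : ℝ) : ℝ := α / (2 * (κ / 2) ^ 2)

/-- `ε_α(γ, κ)` as an explicit value, for integer orders `α ≥ 2`: the guarantee for subsampling
without replacement at rate `γ`, applied to the Gaussian mechanism. As the latter has `ε_∞ = ∞`,
each of the factors `min {2, (e^{ε_∞} - 1) ^ j}` is equal to `2`. -/
def subsampledGaussEps (α : ℕ) (γ κ : ℝ) : ℝ :=
  1 / ((α : ℝ) - 1) * Real.log (1
    + γ ^ 2 * (α.choose 2 : ℝ) *
        min (4 * (Real.exp (gaussEps 2 κ) - 1)) (Real.exp (gaussEps 2 κ) * 2)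
    + ∑ j ∈ Finset.Icc 3 α,
        γ ^ j * (α.choose j : ℝ) * (Real.exp (((j : ℝ) - 1) * gaussEps j κ) * 2))

/-! ### The algorithm -/

/-- Hyperparameters: `T` iterations, reweighting every `k` iterations, learning rate `η`, gradient
clipping threshold `ξ`, model noise scale `σ`, loss temperature `β`, loss sampling rate `γ`,
loss clipping threshold `ζ`, loss noise scale `τ`. -/
structure Hyper where
  T : ℕ
  k : ℕ
  η : ℝ
  ξ : ℝ
  σ : ℝ
  β : ℝ
  γ : ℝ
  ζ : ℝ
  τ : ℝ

/-- Model parameters in `ℝ^d` and group sampling probabilities. -/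
abbrev State (d G : ℕ) : Type := EuclideanSpace ℝ (Fin d) × stdSimplex ℝ (Fin G)

/-- The initial weights `1 / G`. -/
def uniformWeights (G : ℕ) [NeZero G] : stdSimplex ℝ (Fin G) :=
  ⟨fun _ => 1 / (G : ℝ), fun _ => by positivity, by simp⟩

/-- The weights `w g * exp (β * L g)`, normalized to sum to one. -/
def expReweight {G : ℕ} (β : ℝ) (w : stdSimplex ℝ (Fin G)) (L : Fin G → ℝ) :
    stdSimplex ℝ (Fin G) :=
  ⟨fun g => w.1 g * Real.exp (β * L g) / ∑ g', w.1 g' * Real.exp (β * L g'), by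
    have h0 : ∀ g, 0 ≤ w.1 g * Real.exp (β * L g) := fun g =>
      mul_nonneg (w.2.1 g) (Real.exp_pos _).le
    have hpos : 0 < ∑ g', w.1 g' * Real.exp (β * L g') := by
      refine lt_of_le_of_ne (Finset.sum_nonneg fun g _ => h0 g) fun h => ?_
      have hz := (Finset.sum_eq_zero_iff_of_nonneg fun g _ => h0 g).1 h.symm
      have hs : ∑ g, w.1 g = 0 := Finset.sum_eq_zero fun g hg =>
        (mul_eq_zero.1 (hz g hg)).resolve_right (Real.exp_pos _).ne'
      exact zero_ne_one (hs.symm.trans w.2.2)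
    exact ⟨fun g => div_nonneg (h0 g) hpos.le, by rw [← Finset.sum_div, div_self hpos.ne']⟩⟩

section Algorithm

variable {Z : Type*} {d G : ℕ} {n : Fin G → ℕ}

/-- Law of `θ_{t+1}` given `θ_t = S.1` and weights `S.2`: a group `g` is drawn with probabilities
`S.2`, a batch of size `m g` is drawn from its dataset, and one step of noisy clipped gradient
descent is done. -/
def modelUpdate (h : Hyper) (m : Fin G → ℕ) (loss : Z → EuclideanSpace ℝ (Fin d) → ℝ)
    (D : GroupDataset n Z) (S : State d G) : Measure (EuclideanSpace ℝ (Fin d)) :=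
  ∑ g, ENNReal.ofReal (S.2.1 g) •
    (subsampledGaussian (m g) h.ξ h.σ (fun i => gradient (loss (D g i)) S.1)).map
      (fun u => S.1 - (h.η / (m g : ℝ)) • u)

/-- Law of the reweighted group probabilities, given `θ_t = S.1` and weights `S.2`: independently
for each group `g`, the average loss is released from a batch of size `⌊γ n_g⌋`. -/
def weightUpdate (h : Hyper) (loss : Z → EuclideanSpace ℝ (Fin d) → ℝ)
    (D : GroupDataset n Z) (S : State d G) : Measure (stdSimplex ℝ (Fin G)) :=
  (Measure.pi fun g =>
      (subsampledGaussian ⌊h.γ * n g⌋₊ h.ζ h.τ (fun i => loss (D g i) S.1)).map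
        (fun v => 1 / (⌊h.γ * n g⌋₊ : ℝ) * v)).map
    (expReweight h.β S.2)

/-- Iteration `t`. Both updates are computed from `θ_t` and the current weights, with independent
randomness; the weights change only if `k` divides `t`. -/
def step (h : Hyper) (m : Fin G → ℕ) (loss : Z → EuclideanSpace ℝ (Fin d) → ℝ)
    (D : GroupDataset n Z) (t : ℕ) (S : State d G) : Measure (State d G) :=
  (modelUpdate h m loss D S).prod
    (if t % h.k = 0 then weightUpdate h loss D S else Measure.dirac S.2)

/-- Law of the parameters and the weights after `t` iterations, where `init` is the law of the
initial parameters. -/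
def stateLaw [NeZero G] (h : Hyper) (m : Fin G → ℕ) (loss : Z → EuclideanSpace ℝ (Fin d) → ℝ)
    (init : Measure (EuclideanSpace ℝ (Fin d))) (D : GroupDataset n Z) : ℕ → Measure (State d G)
  | 0 => init.prod (Measure.dirac (uniformWeights G))
  | t + 1 => (stateLaw h m loss init D t).bind (step h m loss D (t + 1))

/-- The algorithm with group-specific batch sizes `m`: law of the output `θ_{T+1}`. -/
def groupDRO [NeZero G] (h : Hyper) (m : Fin G → ℕ) (loss : Z → EuclideanSpace ℝ (Fin d) → ℝ)
    (init : Measure (EuclideanSpace ℝ (Fin d))) (D : GroupDataset n Z) :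
    Measure (EuclideanSpace ℝ (Fin d)) :=
  (stateLaw h m loss init D h.T).map Prod.fst

/-- aZB: the same batch size `M` for all groups. aZB-weak is the same algorithm, run with another
choice of `σ / ξ`. -/
def aZB [NeZero G] (h : Hyper) (M : ℕ) (loss : Z → EuclideanSpace ℝ (Fin d) → ℝ)
    (init : Measure (EuclideanSpace ℝ (Fin d))) (D : GroupDataset n Z) :
    Measure (EuclideanSpace ℝ (Fin d)) :=
  groupDRO h (fun _ => M) loss init D

/-- aZB-prop: batch sizes `M_g = ⌊M n_g / n⌋`, where `n = ∑ g, n_g` (division in `ℕ`). -/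
def aZBProp [NeZero G] (h : Hyper) (M : ℕ) (loss : Z → EuclideanSpace ℝ (Fin d) → ℝ)
    (init : Measure (EuclideanSpace ℝ (Fin d))) (D : GroupDataset n Z) :
    Measure (EuclideanSpace ℝ (Fin d)) :=
  groupDRO h (fun g => M * n g / ∑ g', n g') loss init D

end Algorithm

end

end PrivateDRO

/-! The moment bound `∫ (dP/dQ) ^ α dQ ≤ c` is handled through its dual `HolderBound`, which needs
neither joint densities nor disintegration. Post-processing is a change of variables
(`HolderBound.map`), adaptive composition multiplies constants by using the inequality twice
(`HolderBound.bind`), and mixtures with common weights keep the constant by Jensen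
(`HolderBound.sum`). `renyiDiv_le_iff` translates between the two forms, with `c = exp ((α - 1) *
ε)`.

Subsampling: let `i` be the changed index and `0 < m < n`. A uniform batch of size `m` arises by
drawing a core `B` of `m - 1` indices and a spare index `j`, all distinct and different from `i`,
and completing `B` by `i` with probability `q = m / n` and by `j` otherwise. Given `(B, j)`, the two
output laws are, up to a common shift, `(1 - q) N(y) + q N(u)` and `(1 - q) N(y) + q N(u')`, so
quasi-convexity reduces everything to such pairs (`holderBound_subsampledGaussian`).

For the explicit `ε_α`, expand `P ^ α = (Q + (P - Q)) ^ α`. The first-order term integrates to zero,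
`P - Q` carries a factor `q`, convexity of `t ↦ t⁻ᵏ` replaces the mixture in the denominator by
single Gaussians, and the remaining integrals are exact (`holderBound_gaussMix_one`). For the
optimal `ε_α`, what needs proof is that the infimum is attained (`sgmEps_mem`) and monotone in the
rate (`sgmEps_mono`).

Algorithm: a record of group `g` affects an iteration through one component of the mixture over
groups and, when `k ∣ t`, one factor of the product of loss releases. Composition gives `a ^ T * b ^
(T / k)`. The rate `M / n_g` of aZB is worst for the smallest group; in aZB-prop all groups share
the rate `M / n`, up to rounding down. -/

namespace PrivateDRO

/-! ### Dual form of Rényi divergence bounds and its calculus. -/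

section HolderBound

variable {Ω Ω' : Type*} [MeasurableSpace Ω] [MeasurableSpace Ω']

/-- Dual form of the bound `∫ (dP/dQ) ^ α dQ ≤ c`: the functional `h ↦ ∫ h dP` is bounded by
`c ^ (1 / α)` on the unit ball of `L^{α'}(Q)`, where `α'` is the exponent conjugate to `α`. -/
def HolderBound (α : ℝ) (c : ℝ≥0∞) (P Q : Measure Ω) : Prop :=
  ∀ h : Ω → ℝ≥0∞, Measurable h →
    ∫⁻ x, h x ∂P ≤ c ^ (1 / α) * (∫⁻ x, h x ^ α.conjExponent ∂Q) ^ (1 / α.conjExponent)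

variable {α : ℝ} {a b c : ℝ≥0∞} {P Q : Measure Ω}

lemma HolderBound.mono (hα : 1 < α) (h : HolderBound α a P Q) (hab : a ≤ b) :
    HolderBound α b P Q := fun f hf =>
  (h f hf).trans (by gcongr)

/-- A bound on the moments of a density gives the dual bound. -/
lemma holderBound_withDensity (hα : 1 < α) {f : Ω → ℝ≥0∞} (hf : Measurable f)
    (hc : ∫⁻ x, f x ^ α ∂Q ≤ c) : HolderBound α c (Q.withDensity f) Q := by
  intro h hh
  have hconj := Real.HolderConjugate.conjExponent hα
  rw [lintegral_withDensity_eq_lintegral_mul _ hf hh]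
  refine (ENNReal.lintegral_mul_le_Lp_mul_Lq Q hconj hf.aemeasurable hh.aemeasurable).trans ?_
  gcongr

lemma HolderBound.refl (hα : 1 < α) [IsProbabilityMeasure P] (hc : 1 ≤ c) :
    HolderBound α c P P := by
  have := holderBound_withDensity (Q := P) (f := 1) (c := c) hα measurable_one (by simpa using hc)
  rwa [withDensity_one] at this

lemma HolderBound.map {f : Ω → Ω'} (hf : Measurable f) (h : HolderBound α c P Q) :
    HolderBound α c (P.map f) (Q.map f) := by
  intro g hg
  rw [lintegral_map hg hf, lintegral_map (hg.pow_const _) hf]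
  exact h _ (hg.comp hf)

/-- The bound for the kernels leaves the `L^{α'}(K' x)` norm of the test function, as a function of
`x`. This is the test function for the outer bound, and the powers `α'` and `1 / α'` cancel. -/
lemma HolderBound.bind (hα : 1 < α) {K K' : Ω → Measure Ω'} (hK : Measurable K)
    (hK' : Measurable K') (h : HolderBound α a P Q) (hKK' : ∀ x, HolderBound α b (K x) (K' x)) :
    HolderBound α (a * b) (P.bind K) (Q.bind K') := by
  intro g hg
  have hconj := Real.HolderConjugate.conjExponent hα
  have hm : Measurable fun x => ∫⁻ y, g y ^ α.conjExponent ∂(K' x) :=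
    (Measure.measurable_lintegral (hg.pow_const _)).comp hK'
  rw [Measure.lintegral_bind hK.aemeasurable hg.aemeasurable,
    Measure.lintegral_bind hK'.aemeasurable (hg.pow_const _).aemeasurable]
  calc ∫⁻ x, ∫⁻ y, g y ∂(K x) ∂P
      ≤ ∫⁻ x, b ^ (1 / α) *
          (∫⁻ y, g y ^ α.conjExponent ∂(K' x)) ^ (1 / α.conjExponent) ∂P :=
        lintegral_mono fun x => hKK' x g hg
    _ = b ^ (1 / α) *
          ∫⁻ x, (∫⁻ y, g y ^ α.conjExponent ∂(K' x)) ^ (1 / α.conjExponent) ∂P :=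
        lintegral_const_mul _ (hm.pow_const _)
    _ ≤ b ^ (1 / α) * (a ^ (1 / α) *
          (∫⁻ x, ((∫⁻ y, g y ^ α.conjExponent ∂(K' x)) ^ (1 / α.conjExponent)) ^ α.conjExponent
            ∂Q) ^ (1 / α.conjExponent)) := by
        gcongr
        exact h _ (hm.pow_const _)
    _ = _ := by
        rw [← mul_assoc, mul_comm (b ^ _), ENNReal.mul_rpow_of_nonneg _ _ (by positivity)]
        simp_rw [← ENNReal.rpow_mul, one_div, inv_mul_cancel₀ hconj.symm.ne_zero,
          ENNReal.rpow_one]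

lemma HolderBound.prod (hα : 1 < α) {P' Q' : Measure Ω'} [SFinite P'] [SFinite Q']
    (h : HolderBound α a P Q) (h' : HolderBound α b P' Q') :
    HolderBound α (a * b) (P.prod P') (Q.prod Q') := by
  rw [Measure.prod_def, Measure.prod_def]
  exact h.bind hα Measurable.map_prodMk_left Measurable.map_prodMk_left
    fun _ => h'.map measurable_prodMk_left

/-- Quasi-convexity in the pair of measures. -/
lemma HolderBound.sum (hα : 1 < α) {ι : Type*} {s : Finset ι} {w : ι → ℝ≥0∞}
    {P Q : ι → Measure Ω} (hw : ∑ i ∈ s, w i = 1) (h : ∀ i ∈ s, HolderBound α c (P i) (Q i)) :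
    HolderBound α c (∑ i ∈ s, w i • P i) (∑ i ∈ s, w i • Q i) := by
  intro g hg
  have hconj := Real.HolderConjugate.conjExponent hα
  have h1 := hconj.symm.pos
  simp only [lintegral_finsetSum_measure, lintegral_smul_measure, smul_eq_mul]
  calc ∑ i ∈ s, w i * ∫⁻ x, g x ∂(P i)
      ≤ ∑ i ∈ s, w i * (c ^ (1 / α) *
          (∫⁻ x, g x ^ α.conjExponent ∂(Q i)) ^ (1 / α.conjExponent)) := by
        gcongr with i hi
        exact h i hi g hg
    _ = c ^ (1 / α) * ∑ i ∈ s, w i *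
          (∫⁻ x, g x ^ α.conjExponent ∂(Q i)) ^ (1 / α.conjExponent) := by
        rw [Finset.mul_sum]
        exact Finset.sum_congr rfl fun i _ => by ring
    _ ≤ _ := by
        gcongr
        rw [one_div, ENNReal.le_rpow_inv_iff h1]
        -- Jensen for the power `α' ≥ 1`; this is where the weights have to sum to one.
        refine (ENNReal.rpow_arith_mean_le_arith_mean_rpow s w _ hw hconj.symm.lt.le).trans ?_
        simp_rw [← ENNReal.rpow_mul, inv_mul_cancel₀ hconj.symm.ne_zero, ENNReal.rpow_one]
        exact le_rfl

/-- The dual bound gives absolute continuity and the bound on the moment of the density. -/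
lemma HolderBound.absolutelyContinuous (hα : 1 < α) (h : HolderBound α c P Q) :
    P ≪ Q := by
  have hconj := Real.HolderConjugate.conjExponent hα
  refine Measure.AbsolutelyContinuous.mk fun s hs h0 => ?_
  have := h (s.indicator 1) (measurable_one.indicator hs)
  have h2 : ∀ x, s.indicator (1 : Ω → ℝ≥0∞) x ^ α.conjExponent = s.indicator 1 x := fun x => by
    by_cases hx : x ∈ s <;> simp [hx, hconj.symm.pos]
  simp_rw [h2] at this
  rw [lintegral_indicator_one hs, lintegral_indicator_one hs, h0,
    ENNReal.zero_rpow_of_pos (by have := hconj.symm.pos; positivity)] at this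
  simpa using this

/-- Converse of Hölder's inequality: test with the power `α - 1` of the density. Truncating the
density at `n` makes its moment `I` finite, so that `I ^ (1 / α')` can be cancelled; monotone
convergence removes the truncation. -/
lemma HolderBound.lintegral_rnDeriv_le (hα : 1 < α) [IsFiniteMeasure P] [IsFiniteMeasure Q]
    (h : HolderBound α c P Q) : ∫⁻ x, P.rnDeriv Q x ^ α ∂Q ≤ c := by
  have hconj := Real.HolderConjugate.conjExponent hα
  have hac := h.absolutelyContinuous hα
  have hm := Measure.measurable_rnDeriv P Q
  have hα0 : 0 < α := by linarith
  have key : ∀ n : ℕ, ∫⁻ x, (min (P.rnDeriv Q x) n) ^ α ∂Q ≤ c := by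
    intro n
    set f : Ω → ℝ≥0∞ := fun x => min (P.rnDeriv Q x) n with hf
    have hfm : Measurable f := hm.min measurable_const
    have hfin : ∫⁻ x, f x ^ α ∂Q ≠ ∞ := by
      refine ne_top_of_le_ne_top ?_ (lintegral_mono (g := fun _ => (n : ℝ≥0∞) ^ α) fun x => ?_)
      · simp only [lintegral_const]
        exact ENNReal.mul_ne_top (ENNReal.rpow_ne_top_of_nonneg hα0.le (by simp)) (by simp)
      · exact ENNReal.rpow_le_rpow (min_le_right _ _) hα0.le
    have h1 := h (fun x => f x ^ (α - 1)) (hfm.pow_const _)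
    have h2 : ∫⁻ x, f x ^ α ∂Q ≤ ∫⁻ x, f x ^ (α - 1) ∂P := by
      conv_rhs => rw [← Measure.withDensity_rnDeriv_eq P Q hac]
      rw [lintegral_withDensity_eq_lintegral_mul _ hm (hfm.pow_const _)]
      refine lintegral_mono fun x => ?_
      calc f x ^ α = f x ^ (1 + (α - 1)) := by ring_nf
        _ = f x * f x ^ (α - 1) := by
          rw [ENNReal.rpow_add_of_nonneg _ _ zero_le_one (by linarith), ENNReal.rpow_one]
        _ ≤ _ := by
          simp only [Pi.mul_apply]
          gcongr
          exact min_le_left _ _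
    have h3 : ∀ x, (f x ^ (α - 1)) ^ α.conjExponent = f x ^ α := fun x => by
      rw [← ENNReal.rpow_mul, Real.conjExponent]
      congr 1
      field_simp [(by linarith : α - 1 ≠ 0)]
    simp_rw [h3] at h1
    have h4 := h2.trans h1
    set I := ∫⁻ x, f x ^ α ∂Q
    rcases eq_or_ne I 0 with h0 | h0
    · rw [h0]; exact zero_le
    have h5 : I = I ^ (1 / α) * I ^ (1 / α.conjExponent) := by
      rw [← ENNReal.rpow_add _ _ h0 hfin]
      have := hconj.inv_add_inv_eq_one
      simp [this]
    have h6 : I ^ (1 / α.conjExponent) ≠ 0 := by simp [ENNReal.rpow_eq_zero_iff, h0, hfin]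
    have h7 : I ^ (1 / α.conjExponent) ≠ ∞ :=
      ENNReal.rpow_ne_top_of_nonneg (by have := hconj.symm.pos; positivity) hfin
    have h8 := (ENNReal.mul_le_mul_iff_left h6 h7).1 (h5.symm.trans_le h4)
    exact (ENNReal.rpow_le_rpow_iff (by positivity : 0 < 1 / α)).1 h8
  have hlim : ∀ x, P.rnDeriv Q x ^ α = ⨆ n : ℕ, (min (P.rnDeriv Q x) n) ^ α := fun x => by
    have : P.rnDeriv Q x = ⨆ n : ℕ, min (P.rnDeriv Q x) n := by
      rw [← inf_iSup_eq, ENNReal.iSup_natCast]; simp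
    conv_lhs => rw [this]
    exact (ENNReal.monotone_rpow_of_nonneg hα0.le).map_iSup_of_continuousAt
      (ENNReal.continuous_rpow_const.continuousAt) (by simp [hα0])
  simp_rw [hlim]
  rw [lintegral_iSup (fun n => (hm.min measurable_const).pow_const _)]
  · exact iSup_le key
  · intro m n hmn x
    dsimp only
    gcongr

lemma renyiDiv_le_iff (hα : 1 < α) [IsFiniteMeasure P] [IsFiniteMeasure Q] {ε : ℝ} :
    renyiDiv α P Q ≤ (ε : EReal) ↔
      HolderBound α (ENNReal.ofReal (Real.exp ((α - 1) * ε))) P Q := by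
  have hα1 : 0 < α - 1 := by linarith
  have hlog : ∀ I : ℝ≥0∞, ((1 / (α - 1) : ℝ) : EReal) * ENNReal.log I ≤ (ε : EReal) ↔
      I ≤ ENNReal.ofReal (Real.exp ((α - 1) * ε)) := by
    intro I
    rw [one_div, mul_comm, EReal.coe_inv, ← div_eq_mul_inv, EReal.div_le_iff_le_mul
      (by exact_mod_cast hα1) (EReal.coe_ne_top _), ← EReal.coe_mul,
      ← ENNReal.log_le_log_iff (y := ENNReal.ofReal _),
      ENNReal.log_ofReal_of_pos (Real.exp_pos _), Real.log_exp]
  unfold renyiDiv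
  constructor
  · intro h
    split_ifs at h with hac
    · rw [← Measure.withDensity_rnDeriv_eq P Q hac]
      exact holderBound_withDensity hα (Measure.measurable_rnDeriv P Q) ((hlog _).1 h)
    · simp at h
  · intro h
    rw [if_pos (h.absolutelyContinuous hα)]
    exact (hlog _).2 (h.lintegral_rnDeriv_le hα)

/-- Product measures which differ in one factor. -/
lemma HolderBound.pi (hα : 1 < α) {ι : Type*} [Fintype ι] [DecidableEq ι] {X : ι → Type*}
    [∀ i, MeasurableSpace (X i)] {μ ν : ∀ i, Measure (X i)} [∀ i, IsProbabilityMeasure (μ i)]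
    [∀ i, IsProbabilityMeasure (ν i)] (i₀ : ι) (hne : ∀ i, i ≠ i₀ → μ i = ν i)
    (h : HolderBound α c (μ i₀) (ν i₀)) : HolderBound α c (Measure.pi μ) (Measure.pi ν) := by
  have hmeas : Measurable fun z : X i₀ × (∀ i, X i) => Function.update z.2 i₀ z.1 := by
    refine measurable_pi_lambda _ fun i => ?_
    by_cases hi : i = i₀
    · subst hi; simpa using measurable_fst
    · simp only [Function.update_of_ne hi]
      exact (measurable_pi_apply i).comp measurable_snd
  -- Resampling coordinate `i₀` of a `ν`-sample writes both products as images of a binary product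
  -- with common second factor `Measure.pi ν`.
  have key : ∀ ρ : ∀ i, Measure (X i), (∀ i, IsProbabilityMeasure (ρ i)) →
      (∀ i, i ≠ i₀ → ρ i = ν i) → Measure.pi ρ =
        ((ρ i₀).prod (Measure.pi ν)).map fun z => Function.update z.2 i₀ z.1 := by
    intro ρ _ hρ
    refine Measure.pi_eq fun s hs => ?_
    rw [Measure.map_apply hmeas (MeasurableSet.univ_pi hs)]
    have hpre : (fun z : X i₀ × (∀ i, X i) => Function.update z.2 i₀ z.1) ⁻¹'
        (Set.univ.pi s) = s i₀ ×ˢ Set.univ.pi (Function.update s i₀ Set.univ) := by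
      ext z
      simp only [Set.mem_preimage, Set.mem_univ_pi, Set.mem_prod]
      constructor
      · refine fun hz => ⟨by simpa using hz i₀, fun i => ?_⟩
        by_cases hi : i = i₀
        · subst hi; simp
        · simpa [Function.update_of_ne hi] using hz i
      · rintro ⟨hz0, hz⟩ i
        by_cases hi : i = i₀
        · subst hi; simpa using hz0
        · simpa [Function.update_of_ne hi] using hz i
    rw [hpre, Measure.prod_prod, Measure.pi_pi, ← Finset.mul_prod_erase _ _ (Finset.mem_univ i₀),
      ← Finset.mul_prod_erase _ (fun i => ρ i (s i)) (Finset.mem_univ i₀)]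
    simp only [Function.update_self, measure_univ, one_mul]
    congr 1
    refine Finset.prod_congr rfl fun i hi => ?_
    have hi' := Finset.ne_of_mem_erase hi
    rw [Function.update_of_ne hi', hρ i hi']
  have := (h.prod hα (HolderBound.refl hα le_rfl (P := Measure.pi ν))).map hmeas
  rwa [← key μ inferInstance hne, ← key ν inferInstance fun _ _ => rfl, mul_one] at this

end HolderBound

/-! ### Shifts of the standard Gaussian measure and exact moments of their densities. -/

section GaussianShift

open scoped RealInnerProductSpace

variable {E : Type*} [NormedAddCommGroup E] [InnerProductSpace ℝ E]

/-- Density of `N(v, I)` with respect to `N(0, I)`. -/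
noncomputable def shiftDensity (v x : E) : ℝ := Real.exp (⟪v, x⟫ - ‖v‖ ^ 2 / 2)

lemma shiftDensity_pos (v x : E) : 0 < shiftDensity v x := Real.exp_pos _

@[fun_prop]
lemma continuous_shiftDensity (v : E) : Continuous (shiftDensity v) := by
  unfold shiftDensity; fun_prop

lemma shiftDensity_pow_div_pow (u y x : E) (j : ℕ) :
    shiftDensity u x ^ (j + 1) / shiftDensity y x ^ j =
      Real.exp (-((j + 1 : ℝ) * ‖u‖ ^ 2 / 2) + j * ‖y‖ ^ 2 / 2) *
        Real.exp ⟪((j + 1 : ℝ) • u - (j : ℝ) • y), x⟫ := by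
  simp only [shiftDensity, ← Real.exp_nat_mul, ← Real.exp_sub, ← Real.exp_add, inner_sub_left,
    real_inner_smul_left]
  congr 1
  push_cast
  ring

variable [FiniteDimensional ℝ E] [MeasurableSpace E] [BorelSpace E]

/-- Transform at the complex argument `a + i t`, factorized in an orthonormal basis. The case `t =
0` gives exponential moments; general `a` gives the characteristic function of a Gaussian with
density `exp ⟪a, x⟫`, up to normalization. -/
lemma integral_cexp_inner_stdGaussian (a t : E) :
    ∫ x, Complex.exp ((⟪x, a⟫ : ℂ) + (⟪x, t⟫ : ℂ) * Complex.I) ∂(stdGaussian E) =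
      Complex.exp ((‖a‖ ^ 2 - ‖t‖ ^ 2) / 2 + (⟪a, t⟫ : ℂ) * Complex.I) := by
  have h1 : ∀ z : ℂ, ∫ x : ℝ, Complex.exp (z * x) ∂(gaussianReal 0 1) = Complex.exp (z ^ 2 / 2) := by
    intro z
    have := complexMGF_id_gaussianReal (μ := 0) (v := 1) z
    simpa [complexMGF] using this
  rw [stdGaussian, integral_map (Measurable.aemeasurable (by fun_prop))
    (Measurable.aestronglyMeasurable (by fun_prop))]
  set b := stdOrthonormalBasis ℝ E
  have h2 : ∀ x : Fin (Module.finrank ℝ E) → ℝ,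
      Complex.exp ((⟪∑ i, x i • b i, a⟫ : ℂ) + (⟪∑ i, x i • b i, t⟫ : ℂ) * Complex.I) =
        ∏ i, Complex.exp (((⟪b i, a⟫ : ℂ) + (⟪b i, t⟫ : ℂ) * Complex.I) * x i) := by
    intro x
    rw [← Complex.exp_sum, sum_inner, sum_inner]
    congr 1
    simp only [real_inner_smul_left, Complex.ofReal_sum, Complex.ofReal_mul, Finset.sum_mul]
    rw [← Finset.sum_add_distrib]
    exact Finset.sum_congr rfl fun i _ => by ring
  simp_rw [h2]
  rw [integral_fintype_prod_eq_prod
    (f := fun i (x : ℝ) ↦ Complex.exp (((⟪b i, a⟫ : ℂ) + (⟪b i, t⟫ : ℂ) * Complex.I) * x))]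
  rw [Finset.prod_congr rfl fun i _ => h1 _, ← Complex.exp_sum]
  congr 1
  have ha : ((‖a‖ : ℂ)) ^ 2 = ∑ i, (⟪b i, a⟫ : ℂ) ^ 2 := by
    exact_mod_cast (b.sum_sq_inner_right a).symm
  have ht : ((‖t‖ : ℂ)) ^ 2 = ∑ i, (⟪b i, t⟫ : ℂ) ^ 2 := by
    exact_mod_cast (b.sum_sq_inner_right t).symm
  have hat : (⟪a, t⟫ : ℂ) = ∑ i, (⟪b i, a⟫ : ℂ) * (⟪b i, t⟫ : ℂ) := by
    have := (b.sum_inner_mul_inner a t).symm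
    rw [this]
    push_cast
    exact Finset.sum_congr rfl fun i _ => by rw [real_inner_comm a (b i)]
  rw [ha, ht, hat, ← Finset.sum_sub_distrib, Finset.sum_div, Finset.sum_mul,
    ← Finset.sum_add_distrib]
  refine Finset.sum_congr rfl fun i _ => ?_
  ring_nf
  rw [Complex.I_sq]
  ring

lemma integral_exp_inner_stdGaussian (a : E) :
    ∫ x, Real.exp ⟪a, x⟫ ∂(stdGaussian E) = Real.exp (‖a‖ ^ 2 / 2) := by
  have h := integral_cexp_inner_stdGaussian a (0 : E)
  simp only [inner_zero_right, Complex.ofReal_zero, zero_mul, add_zero, norm_zero] at h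
  have h2 : ∀ x : E, Complex.exp (⟪x, a⟫ : ℂ) = ((Real.exp ⟪a, x⟫ : ℝ) : ℂ) := fun x => by
    rw [real_inner_comm, Complex.ofReal_exp]
  simp_rw [h2] at h
  rw [integral_complex_ofReal] at h
  apply Complex.ofReal_injective
  rw [h]
  push_cast
  simp

lemma integrable_exp_inner_stdGaussian (a : E) :
    Integrable (fun x => Real.exp ⟪a, x⟫) (stdGaussian E) := by
  -- A non-integrable function would have integral `0` by convention, but the value found is
  -- positive.
  by_contra h
  have := integral_exp_inner_stdGaussian a
  rw [integral_undef h] at this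
  exact (Real.exp_pos _).ne this

lemma integrable_shiftDensity_pow_div_pow (u y : E) (j : ℕ) :
    Integrable (fun x => shiftDensity u x ^ (j + 1) / shiftDensity y x ^ j) (stdGaussian E) := by
  simp_rw [shiftDensity_pow_div_pow]
  exact (integrable_exp_inner_stdGaussian _).const_mul _

lemma integral_shiftDensity_pow_div_pow (u y : E) (j : ℕ) :
    ∫ x, shiftDensity u x ^ (j + 1) / shiftDensity y x ^ j ∂(stdGaussian E) =
      Real.exp ((j + 1) * j / 2 * ‖u - y‖ ^ 2) := by
  simp_rw [shiftDensity_pow_div_pow]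
  rw [integral_const_mul, integral_exp_inner_stdGaussian, ← Real.exp_add]
  congr 1
  rw [@norm_sub_sq ℝ, @norm_sub_sq ℝ, norm_smul, norm_smul, real_inner_smul_left,
    real_inner_smul_right]
  simp only [Real.norm_eq_abs, mul_pow, sq_abs, RCLike.re_to_real]
  ring

lemma integrable_shiftDensity (u : E) : Integrable (shiftDensity u) (stdGaussian E) := by
  simpa using integrable_shiftDensity_pow_div_pow u 0 0

lemma integral_shiftDensity (u : E) : ∫ x, shiftDensity u x ∂(stdGaussian E) = 1 := by
  simpa using integral_shiftDensity_pow_div_pow u 0 0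

/-- The Cameron–Martin formula, checked on characteristic functions. -/
lemma map_add_stdGaussian (v : E) :
    (stdGaussian E).map (fun w => v + w) =
      (stdGaussian E).withDensity fun x => ENNReal.ofReal (shiftDensity v x) := by
  have hm : Measurable fun w : E => v + w := by fun_prop
  have : IsProbabilityMeasure ((stdGaussian E).map fun w => v + w) :=
    Measure.isProbabilityMeasure_map hm.aemeasurable
  have : IsFiniteMeasure ((stdGaussian E).withDensity fun x =>
      ENNReal.ofReal (shiftDensity v x)) :=
    isFiniteMeasure_withDensity_ofReal (integrable_shiftDensity v).2
  refine Measure.ext_of_charFun (E := E) (funext fun t => ?_)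
  rw [charFun_apply, charFun_apply, integral_map hm.aemeasurable (by fun_prop),
    integral_withDensity_eq_integral_toReal_smul
      (by have := continuous_shiftDensity v; fun_prop) (by simp)]
  have h1 := integral_cexp_inner_stdGaussian (0 : E) t
  have h2 := integral_cexp_inner_stdGaussian v t
  have e1 : ∀ x, Complex.exp ((⟪v + x, t⟫ : ℂ) * Complex.I) =
      Complex.exp ((⟪v, t⟫ : ℂ) * Complex.I) *
        Complex.exp ((⟪x, (0 : E)⟫ : ℂ) + (⟪x, t⟫ : ℂ) * Complex.I) := fun x => by
    rw [← Complex.exp_add]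
    congr 1
    simp [inner_add_left]
    ring
  have e2 : ∀ x, (ENNReal.ofReal (shiftDensity v x)).toReal •
      Complex.exp ((⟪x, t⟫ : ℂ) * Complex.I) = Complex.exp (-(‖v‖ : ℂ) ^ 2 / 2) *
        Complex.exp ((⟪x, v⟫ : ℂ) + (⟪x, t⟫ : ℂ) * Complex.I) := fun x => by
    rw [ENNReal.toReal_ofReal (shiftDensity_pos v x).le, Complex.real_smul, shiftDensity,
      Complex.ofReal_exp, ← Complex.exp_add, ← Complex.exp_add]
    congr 1
    rw [real_inner_comm]
    push_cast
    ring
  simp_rw [e1, e2]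
  rw [integral_const_mul, integral_const_mul, h1, h2, ← Complex.exp_add, ← Complex.exp_add]
  congr 1
  simp
  ring

end GaussianShift

/-! ### The explicit moment and the elementary inequalities behind it. -/

section Moment

/-- The moment `exp ((α - 1) * ε_α(γ, κ))` of the explicit guarantee. -/
noncomputable def subsampledGaussMoment (a : ℕ) (γ κ : ℝ) : ℝ :=
  1 + γ ^ 2 * (a.choose 2 : ℝ) *
        min (4 * (Real.exp (gaussEps 2 κ) - 1)) (Real.exp (gaussEps 2 κ) * 2)
    + ∑ j ∈ Finset.Icc 3 a,
        γ ^ j * (a.choose j : ℝ) * (Real.exp (((j : ℝ) - 1) * gaussEps j κ) * 2)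

lemma gaussEps_nonneg {α : ℝ} (hα : 0 ≤ α) (κ : ℝ) : 0 ≤ gaussEps α κ := by
  unfold gaussEps; positivity

lemma min_gaussEps_two_nonneg (κ : ℝ) :
    0 ≤ min (4 * (Real.exp (gaussEps 2 κ) - 1)) (Real.exp (gaussEps 2 κ) * 2) := by
  have := Real.one_le_exp (gaussEps_nonneg zero_le_two κ)
  exact le_min (by linarith) (by positivity)

lemma one_le_subsampledGaussMoment (a : ℕ) {γ : ℝ} (hγ : 0 ≤ γ) (κ : ℝ) :
    1 ≤ subsampledGaussMoment a γ κ := by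
  have := min_gaussEps_two_nonneg κ
  unfold subsampledGaussMoment
  have h1 : 0 ≤ ∑ j ∈ Finset.Icc 3 a,
    γ ^ j * (a.choose j : ℝ) * (Real.exp (((j : ℝ) - 1) * gaussEps j κ) * 2) :=
    Finset.sum_nonneg fun j _ => by positivity
  have h2 : 0 ≤ γ ^ 2 * (a.choose 2 : ℝ) *
    min (4 * (Real.exp (gaussEps 2 κ) - 1)) (Real.exp (gaussEps 2 κ) * 2) := by positivity
  linarith

lemma subsampledGaussMoment_mono (a : ℕ) {γ γ' : ℝ} (hγ : 0 ≤ γ) (h : γ ≤ γ') (κ : ℝ) :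
    subsampledGaussMoment a γ κ ≤ subsampledGaussMoment a γ' κ := by
  have := min_gaussEps_two_nonneg κ
  unfold subsampledGaussMoment
  gcongr

lemma abs_sub_pow_le {A B : ℝ} (hA : 0 ≤ A) (hB : 0 ≤ B) (n : ℕ) :
    |A - B| ^ n ≤ A ^ n + B ^ n := by
  rcases le_total A B with h | h
  · have h1 : |A - B| ≤ B := by rw [abs_sub_comm, abs_of_nonneg] <;> linarith
    have := pow_le_pow_left₀ (abs_nonneg _) h1 n
    have := pow_nonneg hA n
    linarith
  · have h1 : |A - B| ≤ A := by rw [abs_of_nonneg] <;> linarith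
    have := pow_le_pow_left₀ (abs_nonneg _) h1 n
    have := pow_nonneg hB n
    linarith

lemma inv_pow_mix_le {q R B : ℝ} (hq : 0 ≤ q) (hq' : q ≤ 1) (hR : 0 < R) (hB : 0 < B) (k : ℕ) :
    1 / ((1 - q) * R + q * B) ^ k ≤ (1 - q) * (1 / R ^ k) + q * (1 / B ^ k) := by
  have := (convexOn_zpow (-(k : ℤ))).2 (Set.mem_Ioi.2 hR) (Set.mem_Ioi.2 hB)
    (by linarith : 0 ≤ 1 - q) hq (by ring)
  simpa [zpow_neg] using this

/-- Binomial expansion of `(Q + (P - Q)) ^ (b + 2)`. Absolute values are lossy only from order three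
on; the linear term keeps its sign because it has to cancel after integration. -/
lemma pow_div_pow_le_sum {P Q : ℝ} (hQ : 0 < Q) (b : ℕ) :
    P ^ (b + 2) / Q ^ (b + 1) ≤ Q + (b + 2) * (P - Q) + ((b + 2).choose 2 : ℝ) * (|P - Q| ^ 2 / Q)
      + ∑ j ∈ Finset.Icc 3 (b + 2), ((b + 2).choose j : ℝ) * (|P - Q| ^ j / Q ^ (j - 1)) := by
  have h0 : P ^ (b + 2) = ∑ j ∈ Finset.range (b + 2 + 1),
      (P - Q) ^ j * Q ^ (b + 2 - j) * ((b + 2).choose j : ℝ) := by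
    rw [← add_pow, sub_add_cancel]
  have h1 : Finset.Icc 3 (b + 2) = Finset.Ico 3 (b + 3) := by ext; simp; omega
  rw [h0, h1, Finset.sum_Ico_eq_sum_range, Finset.sum_div, Finset.sum_range_succ',
    Finset.sum_range_succ', Finset.sum_range_succ']
  have h2 : ∀ j ∈ Finset.range b,
      (P - Q) ^ (j + 1 + 1 + 1) * Q ^ (b + 2 - (j + 1 + 1 + 1)) *
        ((b + 2).choose (j + 1 + 1 + 1) : ℝ) / Q ^ (b + 1) ≤
      ((b + 2).choose (3 + j) : ℝ) * (|P - Q| ^ (3 + j) / Q ^ (3 + j - 1)) := by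
    intro j hj
    have hj' := Finset.mem_range.1 hj
    have e1 : Q ^ (b + 1) = Q ^ (b + 2 - (j + 1 + 1 + 1)) * Q ^ (3 + j - 1) := by
      rw [← pow_add]; congr 1; omega
    have e2 : j + 1 + 1 + 1 = 3 + j := by ring
    have h3 : (P - Q) ^ (3 + j) ≤ |P - Q| ^ (3 + j) := by
      rw [← abs_pow]; exact le_abs_self _
    rw [e1, e2]
    have hQ1 : (0 : ℝ) < Q ^ (b + 2 - (3 + j)) := by positivity
    calc _ = ((b + 2).choose (3 + j) : ℝ) * ((P - Q) ^ (3 + j) / Q ^ (3 + j - 1)) := by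
          field_simp
      _ ≤ _ := by gcongr
  have h4 := Finset.sum_le_sum h2
  have e3 : b + 3 - 3 = b := by omega
  rw [e3]
  have e4 : (P - Q) ^ (0 + 1 + 1) * Q ^ (b + 2 - (0 + 1 + 1)) * ((b + 2).choose (0 + 1 + 1) : ℝ) /
      Q ^ (b + 1) = ((b + 2).choose 2 : ℝ) * (|P - Q| ^ 2 / Q) := by
    simp only [zero_add, Nat.reduceAdd, Nat.add_sub_cancel, sq_abs, pow_succ Q b]
    field_simp
  have e5 : (P - Q) ^ (0 + 1) * Q ^ (b + 2 - (0 + 1)) * ((b + 2).choose (0 + 1) : ℝ) /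
      Q ^ (b + 1) = (b + 2) * (P - Q) := by
    have : b + 2 - 1 = b + 1 := by omega
    simp only [zero_add, this, Nat.choose_one_right]
    push_cast
    field_simp
  have e6 : (P - Q) ^ 0 * Q ^ (b + 2 - 0) * ((b + 2).choose 0 : ℝ) / Q ^ (b + 1) = Q := by
    simp only [pow_zero, Nat.sub_zero, Nat.choose_zero_right, pow_succ Q (b + 1)]
    push_cast
    field_simp
  rw [e4, e5, e6]
  linarith

end Moment

/-! ### Moments for two Gaussian mixtures sharing one component. -/

section GaussMix

variable {E : Type*} [NormedAddCommGroup E] [InnerProductSpace ℝ E]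
  [FiniteDimensional ℝ E] [MeasurableSpace E] [BorelSpace E]

/-- The factor `2` comes from `|A - B| ^ n ≤ A ^ n + B ^ n`: both summands have the exact Gaussian
value, at distance at most `r`. -/
lemma integral_abs_sub_pow_div_pow_le {u u' y : E} {r : ℝ} (hu : ‖u - y‖ ≤ r)
    (hu' : ‖u' - y‖ ≤ r) (k : ℕ) :
    Integrable (fun x => |shiftDensity u x - shiftDensity u' x| ^ (k + 1) / shiftDensity y x ^ k)
      (stdGaussian E) ∧
    ∫ x, |shiftDensity u x - shiftDensity u' x| ^ (k + 1) / shiftDensity y x ^ k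
      ∂(stdGaussian E) ≤ Real.exp (k * ((k + 1) / 2 * r ^ 2)) * 2 := by
  have hI := (integrable_shiftDensity_pow_div_pow u y k).add
    (integrable_shiftDensity_pow_div_pow u' y k)
  have hle : ∀ x : E, |shiftDensity u x - shiftDensity u' x| ^ (k + 1) / shiftDensity y x ^ k ≤
      shiftDensity u x ^ (k + 1) / shiftDensity y x ^ k +
        shiftDensity u' x ^ (k + 1) / shiftDensity y x ^ k := fun x => by
    rw [← add_div]
    have := shiftDensity_pos y x
    gcongr
    exact abs_sub_pow_le (shiftDensity_pos _ _).le (shiftDensity_pos _ _).le _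
  have hnn : ∀ x : E,
      0 ≤ |shiftDensity u x - shiftDensity u' x| ^ (k + 1) / shiftDensity y x ^ k := fun x => by
    have := shiftDensity_pos y x
    positivity
  have hint : Integrable (fun x => |shiftDensity u x - shiftDensity u' x| ^ (k + 1) /
      shiftDensity y x ^ k) (stdGaussian E) := by
    refine hI.mono' (Continuous.aestronglyMeasurable ?_) (ae_of_all _ fun x => ?_)
    · exact Continuous.div (by fun_prop) (by fun_prop)
        fun x => (pow_pos (shiftDensity_pos y x) k).ne'
    · rw [Real.norm_of_nonneg (hnn x)]
      exact hle x
  refine ⟨hint, (integral_mono hint hI hle).trans ?_⟩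
  simp only [Pi.add_apply]
  rw [integral_add (integrable_shiftDensity_pow_div_pow u y k)
    (integrable_shiftDensity_pow_div_pow u' y k), integral_shiftDensity_pow_div_pow,
    integral_shiftDensity_pow_div_pow, mul_two]
  have h1 : ∀ v : E, ‖v - y‖ ≤ r → Real.exp ((k + 1) * k / 2 * ‖v - y‖ ^ 2) ≤
      Real.exp (k * ((k + 1) / 2 * r ^ 2)) := fun v hv => by
    rw [show (k : ℝ) * ((k + 1) / 2 * r ^ 2) = (k + 1) * k / 2 * r ^ 2 by ring]
    gcongr
  exact add_le_add (h1 u hu) (h1 u' hu')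

/-- For the densities, `(p_u - p_u')² ≤ 2 (p_u - p_y)² + 2 (p_u' - p_y)²`, and each `χ²` integral `∫
(p_v - p_y)² / p_y` equals `exp (‖v - y‖²) - 1`. This alternative is the better one for small `r`.
-/
lemma integral_sq_sub_div_le {u u' y : E} {r : ℝ} (hu : ‖u - y‖ ≤ r) (hu' : ‖u' - y‖ ≤ r) :
    ∫ x, |shiftDensity u x - shiftDensity u' x| ^ 2 / shiftDensity y x ∂(stdGaussian E) ≤
      4 * (Real.exp (r ^ 2) - 1) := by
  have hsq : ∀ v : E, Integrable (fun x => shiftDensity v x ^ 2 / shiftDensity y x)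
      (stdGaussian E) := fun v => by
    simpa using integrable_shiftDensity_pow_div_pow v y 1
  have hsq' : ∀ v : E, ‖v - y‖ ≤ r →
      ∫ x, shiftDensity v x ^ 2 / shiftDensity y x ∂(stdGaussian E) ≤ Real.exp (r ^ 2) := by
    intro v hv
    have := integral_shiftDensity_pow_div_pow v y 1
    simp only [Nat.reduceAdd, pow_one, Nat.cast_one] at this
    rw [this]
    gcongr
    norm_num
    gcongr
  set f : E → E → ℝ := fun v x =>
    2 * (shiftDensity v x ^ 2 / shiftDensity y x - 2 * shiftDensity v x + shiftDensity y x)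
  have hd : ∀ v, Integrable
      (fun x => shiftDensity v x ^ 2 / shiftDensity y x - 2 * shiftDensity v x)
      (stdGaussian E) := fun v => (hsq v).sub ((integrable_shiftDensity v).const_mul 2)
  have hf : ∀ v, Integrable (f v) (stdGaussian E) := fun v =>
    ((hd v).add (integrable_shiftDensity y)).const_mul 2
  have hf' : ∀ v, ‖v - y‖ ≤ r → ∫ x, f v x ∂(stdGaussian E) ≤ 2 * (Real.exp (r ^ 2) - 1) := by
    intro v hv
    simp only [f]
    rw [integral_const_mul, integral_add (hd v) (integrable_shiftDensity y),
      integral_sub (hsq v) ((integrable_shiftDensity v).const_mul 2),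
      integral_const_mul, integral_shiftDensity, integral_shiftDensity]
    linarith [hsq' v hv]
  have hint := (integral_abs_sub_pow_div_pow_le hu hu' 1).1
  simp only [Nat.reduceAdd, pow_one] at hint
  calc _ ≤ ∫ x, (f u x + f u' x) ∂(stdGaussian E) := by
        refine integral_mono hint ((hf u).add (hf u')) fun x => ?_
        have hy := shiftDensity_pos y x
        simp only [f, sq_abs]
        rw [div_le_iff₀ hy]
        field_simp
        nlinarith [sq_nonneg (shiftDensity u x + shiftDensity u' x - 2 * shiftDensity y x)]
    _ ≤ _ := by
        rw [integral_add (hf u) (hf u')]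
        linarith [hf' u hu, hf' u' hu']

/-- Law of `v + N(0, s² I)`. -/
noncomputable def gaussAt (s : ℝ) (v : E) : Measure E :=
  (stdGaussian E).map fun w => v + s • w

/-- The mixture of `N(y, s² I)` and `N(u, s² I)` with weights `1 - q` and `q`. -/
noncomputable def gaussMix (q s : ℝ) (y u : E) : Measure E :=
  ENNReal.ofReal (1 - q) • gaussAt s y + ENNReal.ofReal q • gaussAt s u

instance isProbabilityMeasure_gaussAt (s : ℝ) (v : E) : IsProbabilityMeasure (gaussAt s v) :=
  Measure.isProbabilityMeasure_map (by fun_prop)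

/-- Rotation invariance of the noise; it covers translations, rescalings and changes of the ambient
space at once. -/
lemma map_gaussAt {F : Type*} [NormedAddCommGroup F] [InnerProductSpace ℝ F]
    [FiniteDimensional ℝ F] [MeasurableSpace F] [BorelSpace F] {f : E → F} (hf : Measurable f)
    {s s' : ℝ} {v : E} {v' : F} (g : E ≃ₗᵢ[ℝ] F) (h : ∀ w, f (v + s • w) = v' + s' • g w) :
    (gaussAt s v).map f = gaussAt s' v' := by
  rw [gaussAt, gaussAt, ← stdGaussian_map g, Measure.map_map hf (by fun_prop),
    Measure.map_map (by fun_prop) (by fun_prop)]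
  exact congrArg (fun k => Measure.map k (stdGaussian E)) (funext h)

lemma map_gaussMix {F : Type*} [NormedAddCommGroup F] [InnerProductSpace ℝ F]
    [FiniteDimensional ℝ F] [MeasurableSpace F] [BorelSpace F] {f : E → F} (hf : Measurable f)
    (q : ℝ) {s s' : ℝ} {y u : E} {y' u' : F} (g : E ≃ₗᵢ[ℝ] F)
    (hy : ∀ w, f (y + s • w) = y' + s' • g w) (hu : ∀ w, f (u + s • w) = u' + s' • g w) :
    (gaussMix q s y u).map f = gaussMix q s' y' u' := by
  rw [gaussMix, gaussMix, Measure.map_add _ _ hf, Measure.map_smul, Measure.map_smul,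
    map_gaussAt hf g hy, map_gaussAt hf g hu]

lemma gaussMix_one_eq_withDensity {q : ℝ} (hq : 0 ≤ q) (hq' : q ≤ 1) (y u : E) :
    gaussMix q 1 y u = (stdGaussian E).withDensity fun x =>
      ENNReal.ofReal ((1 - q) * shiftDensity y x + q * shiftDensity u x) := by
  have hm : ∀ v : E, Measurable fun x => ENNReal.ofReal (shiftDensity v x) := fun v => by
    have := continuous_shiftDensity v
    fun_prop
  have h1 : ∀ v : E, gaussAt 1 v = (stdGaussian E).withDensity fun x =>
      ENNReal.ofReal (shiftDensity v x) := fun v => by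
    simp only [gaussAt, one_smul, map_add_stdGaussian]
  rw [gaussMix, h1, h1, ← withDensity_smul _ (hm y), ← withDensity_smul _ (hm u),
    ← withDensity_add_left ((hm y).const_smul _)]
  congr 1
  funext x
  have := shiftDensity_pos y x
  have := shiftDensity_pos u x
  simp only [Pi.add_apply, Pi.smul_apply, smul_eq_mul]
  rw [ENNReal.ofReal_add (mul_nonneg (by linarith) (by positivity)) (by positivity),
    ENNReal.ofReal_mul (by linarith), ENNReal.ofReal_mul hq]

/-- By convexity of `t ↦ t⁻ᵏ`, a bound valid for each of the two pure denominators holds for their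
mixture. -/
lemma integral_mix_abs_sub_pow_le {q : ℝ} (hq : 0 ≤ q) (hq' : q ≤ 1) {y u u' : E} (k : ℕ) {w : ℝ}
    (hy : Integrable (fun x => |shiftDensity u x - shiftDensity u' x| ^ (k + 1) /
      shiftDensity y x ^ k) (stdGaussian E))
    (hyw : ∫ x, |shiftDensity u x - shiftDensity u' x| ^ (k + 1) / shiftDensity y x ^ k
      ∂(stdGaussian E) ≤ w)
    (hu : Integrable (fun x => |shiftDensity u x - shiftDensity u' x| ^ (k + 1) /
      shiftDensity u' x ^ k) (stdGaussian E))
    (huw : ∫ x, |shiftDensity u x - shiftDensity u' x| ^ (k + 1) / shiftDensity u' x ^ k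
      ∂(stdGaussian E) ≤ w) :
    Integrable (fun x => |shiftDensity u x - shiftDensity u' x| ^ (k + 1) /
      ((1 - q) * shiftDensity y x + q * shiftDensity u' x) ^ k) (stdGaussian E) ∧
    ∫ x, |shiftDensity u x - shiftDensity u' x| ^ (k + 1) /
      ((1 - q) * shiftDensity y x + q * shiftDensity u' x) ^ k ∂(stdGaussian E) ≤ w := by
  have hQ : ∀ x : E, 0 < (1 - q) * shiftDensity y x + q * shiftDensity u' x := fun x => by
    have := shiftDensity_pos y x
    have := shiftDensity_pos u' x
    rcases hq.eq_or_lt with h | h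
    · subst h; simpa
    · have : 0 ≤ (1 - q) * shiftDensity y x := mul_nonneg (by linarith) (by positivity)
      positivity
  have hI := (hy.const_mul (1 - q)).add (hu.const_mul q)
  have hle : ∀ x : E, |shiftDensity u x - shiftDensity u' x| ^ (k + 1) /
      ((1 - q) * shiftDensity y x + q * shiftDensity u' x) ^ k ≤
      (1 - q) * (|shiftDensity u x - shiftDensity u' x| ^ (k + 1) / shiftDensity y x ^ k) +
      q * (|shiftDensity u x - shiftDensity u' x| ^ (k + 1) / shiftDensity u' x ^ k) := fun x => by
    have := mul_le_mul_of_nonneg_left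
      (inv_pow_mix_le hq hq' (shiftDensity_pos y x) (shiftDensity_pos u' x) k)
      (pow_nonneg (abs_nonneg (shiftDensity u x - shiftDensity u' x)) (k + 1))
    calc _ = _ := by rw [div_eq_mul_one_div]
      _ ≤ _ := this
      _ = _ := by ring
  have hint : Integrable (fun x => |shiftDensity u x - shiftDensity u' x| ^ (k + 1) /
      ((1 - q) * shiftDensity y x + q * shiftDensity u' x) ^ k) (stdGaussian E) := by
    refine hI.mono' (Continuous.aestronglyMeasurable ?_) (ae_of_all _ fun x => ?_)
    · exact Continuous.div (by fun_prop) (by fun_prop) fun x => (pow_pos (hQ x) k).ne'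
    · rw [Real.norm_of_nonneg]
      · exact hle x
      · have := hQ x
        positivity
  refine ⟨hint, (integral_mono hint hI hle).trans ?_⟩
  simp only [Pi.add_apply]
  rw [integral_add (hy.const_mul _) (hu.const_mul _), integral_const_mul, integral_const_mul]
  calc _ ≤ (1 - q) * w + q * w := by
        have : 0 ≤ 1 - q := by linarith
        gcongr
    _ = w := by ring

/-- Amplification by subsampling without replacement for two Gaussian mixtures. -/
lemma holderBound_gaussMix_one {a : ℕ} (ha : 2 ≤ a) {q κ : ℝ} (hq : 0 ≤ q) (hq' : q ≤ 1)
    {y u u' : E} (hu : ‖u - y‖ ≤ 2 / κ) (hu' : ‖u' - y‖ ≤ 2 / κ) (huu' : ‖u - u'‖ ≤ 2 / κ) :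
    HolderBound a (ENNReal.ofReal (subsampledGaussMoment a q κ))
      (gaussMix q 1 y u) (gaussMix q 1 y u') := by
  obtain ⟨b, rfl⟩ : ∃ b, a = b + 2 := ⟨a - 2, by omega⟩
  have hκ : 0 ≤ 2 / κ := (norm_nonneg _).trans hu
  set μ := stdGaussian E
  set P : E → ℝ := fun x => (1 - q) * shiftDensity y x + q * shiftDensity u x with hP
  set Q : E → ℝ := fun x => (1 - q) * shiftDensity y x + q * shiftDensity u' x with hQ
  have hpos : ∀ v x : E, 0 < (1 - q) * shiftDensity y x + q * shiftDensity v x := fun v x => by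
    have := shiftDensity_pos y x
    have := shiftDensity_pos v x
    rcases hq.eq_or_lt with h | h
    · subst h; simpa
    · have : 0 ≤ (1 - q) * shiftDensity y x := mul_nonneg (by linarith) (by positivity)
      positivity
  have hPpos : ∀ x, 0 < P x := hpos u
  have hQpos : ∀ x, 0 < Q x := hpos u'
  have hPc : Continuous P := by simp only [hP]; fun_prop
  have hQc : Continuous Q := by simp only [hQ]; fun_prop
  have hPint : Integrable P μ :=
    ((integrable_shiftDensity y).const_mul _).add ((integrable_shiftDensity u).const_mul _)
  have hQint : Integrable Q μ :=
    ((integrable_shiftDensity y).const_mul _).add ((integrable_shiftDensity u').const_mul _)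
  have hP1 : ∫ x, P x ∂μ = 1 := by
    simp only [hP]
    rw [integral_add ((integrable_shiftDensity y).const_mul _)
      ((integrable_shiftDensity u).const_mul _), integral_const_mul, integral_const_mul,
      integral_shiftDensity, integral_shiftDensity]
    ring
  have hQ1 : ∫ x, Q x ∂μ = 1 := by
    simp only [hQ]
    rw [integral_add ((integrable_shiftDensity y).const_mul _)
      ((integrable_shiftDensity u').const_mul _), integral_const_mul, integral_const_mul,
      integral_shiftDensity, integral_shiftDensity]
    ring
  -- the moments of `(P - Q) / Q`
  set T : ℕ → E → ℝ := fun k x => |P x - Q x| ^ (k + 1) / Q x ^ k with hT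
  have hTeq : ∀ k x, T k x = q ^ (k + 1) *
      (|shiftDensity u x - shiftDensity u' x| ^ (k + 1) / Q x ^ k) := fun k x => by
    have : P x - Q x = q * (shiftDensity u x - shiftDensity u' x) := by simp only [hP, hQ]; ring
    simp only [hT, this, abs_mul, abs_of_nonneg hq, mul_pow]
    ring
  have hself : ‖u' - u'‖ ≤ 2 / κ := by simpa using hκ
  have hmom : ∀ k : ℕ, Integrable (T k) μ ∧
      ∫ x, T k x ∂μ ≤ q ^ (k + 1) * (Real.exp (k * ((k + 1) / 2 * (2 / κ) ^ 2)) * 2) := by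
    intro k
    have h1 := integral_abs_sub_pow_div_pow_le hu hu' k
    -- The pure denominator centred at `u'`: here `u'` takes the place of `y`, whence the need for
    -- `huu'`.
    have h2 := integral_abs_sub_pow_div_pow_le huu' hself k
    have h3 := integral_mix_abs_sub_pow_le hq hq' k h1.1 h1.2 h2.1 h2.2
    simp_rw [funext (hTeq k)]
    refine ⟨h3.1.const_mul _, ?_⟩
    rw [integral_const_mul]
    gcongr
    exact h3.2
  have hmom2 : ∫ x, T 1 x ∂μ ≤ q ^ 2 * (4 * (Real.exp ((2 / κ) ^ 2) - 1)) := by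
    have h1 := integral_abs_sub_pow_div_pow_le hu hu' 1
    have h2 := integral_abs_sub_pow_div_pow_le huu' hself 1
    have h3 := integral_mix_abs_sub_pow_le hq hq' 1 h1.1
      (by simpa using integral_sq_sub_div_le hu hu') h2.1
      (by simpa using integral_sq_sub_div_le huu' hself)
    simp_rw [funext (hTeq 1)]
    rw [integral_const_mul]
    gcongr
    exact h3.2
  have heps : ∀ j : ℕ, gaussEps j κ = (j : ℝ) / 2 * (2 / κ) ^ 2 := fun j => by
    unfold gaussEps
    rw [div_pow, div_pow]
    rcases eq_or_ne κ 0 with h | h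
    · simp [h]
    · field_simp
  have heps2 : gaussEps 2 κ = (2 / κ) ^ 2 := by have := heps 2; push_cast at this; rw [this]; ring
  -- the bound to be integrated
  set S : E → ℝ := fun x => Q x + (b + 2) * (P x - Q x) + ((b + 2).choose 2 : ℝ) * T 1 x
      + ∑ j ∈ Finset.Icc 3 (b + 2), ((b + 2).choose j : ℝ) * T (j - 1) x with hS
  have hptw : ∀ x, P x ^ (b + 2) / Q x ^ (b + 1) ≤ S x := fun x => by
    refine (pow_div_pow_le_sum (hQpos x) b).trans (le_of_eq ?_)
    simp only [hS, hT, pow_one]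
    congr 1
    refine Finset.sum_congr rfl fun j hj => ?_
    have : j - 1 + 1 = j := by have := (Finset.mem_Icc.1 hj).1; omega
    rw [this]
  have hI0 : Integrable (fun x => ((b : ℝ) + 2) * (P x - Q x)) μ := (hPint.sub hQint).const_mul _
  have hI1 : Integrable (fun x => Q x + (b + 2) * (P x - Q x)) μ :=
    hQint.add hI0
  have hI2 : Integrable (fun x => ((b + 2).choose 2 : ℝ) * T 1 x) μ := (hmom 1).1.const_mul _
  have hI3 : ∀ j ∈ Finset.Icc 3 (b + 2),
      Integrable (fun x => ((b + 2).choose j : ℝ) * T (j - 1) x) μ := fun j _ =>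
    (hmom _).1.const_mul _
  have hI12 : Integrable (fun x => Q x + (b + 2) * (P x - Q x) +
      ((b + 2).choose 2 : ℝ) * T 1 x) μ := hI1.add hI2
  have hSint : Integrable S μ := hI12.add (integrable_finsetSum _ hI3)
  have hSle : ∫ x, S x ∂μ ≤ subsampledGaussMoment (b + 2) q κ := by
    simp only [hS]
    rw [integral_add hI12 (integrable_finsetSum _ hI3), integral_add hI1 hI2,
      integral_add hQint hI0, integral_const_mul, integral_const_mul,
      integral_sub hPint hQint, hP1, hQ1, integral_finsetSum _ hI3, subsampledGaussMoment]
    -- The terms of order zero and one give exactly `1`, as `P` and `Q` have the same integral.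
    refine add_le_add (add_le_add (by simp) ?_) (Finset.sum_le_sum fun j hj => ?_)
    · rw [heps2, mul_comm (q ^ 2), mul_assoc]
      gcongr
      rw [mul_min_of_nonneg _ _ (by positivity)]
      refine le_min hmom2 ((hmom 1).2.trans (le_of_eq ?_))
      norm_num
    · have hj3 := (Finset.mem_Icc.1 hj).1
      obtain ⟨k, rfl⟩ : ∃ k, j = k + 1 := ⟨j - 1, by omega⟩
      rw [integral_const_mul, mul_comm (q ^ (k + 1)), mul_assoc, heps]
      gcongr
      refine (hmom _).2.trans (le_of_eq ?_)
      simp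
  -- conclusion
  have hfm : Measurable fun x => ENNReal.ofReal (P x / Q x) := by
    have := hPc.measurable
    have := hQc.measurable
    fun_prop
  have hQm : Measurable fun x => ENNReal.ofReal (Q x) := by
    have := hQc.measurable
    fun_prop
  rw [gaussMix_one_eq_withDensity hq hq', gaussMix_one_eq_withDensity hq hq']
  have hPQ : μ.withDensity (fun x => ENNReal.ofReal (P x)) =
      (μ.withDensity fun x => ENNReal.ofReal (Q x)).withDensity
        fun x => ENNReal.ofReal (P x / Q x) := by
    rw [← withDensity_mul _ hQm hfm]
    congr 1
    funext x
    rw [Pi.mul_apply, ← ENNReal.ofReal_mul (hQpos x).le, mul_div_cancel₀ _ (hQpos x).ne']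
  change HolderBound _ _ (μ.withDensity fun x => ENNReal.ofReal (P x))
    (μ.withDensity fun x => ENNReal.ofReal (Q x))
  rw [hPQ]
  refine holderBound_withDensity (by push_cast; linarith [(Nat.cast_nonneg b : (0 : ℝ) ≤ b)])
    hfm ?_
  rw [lintegral_withDensity_eq_lintegral_mul _ hQm (hfm.pow_const _)]
  calc _ = ∫⁻ x, ENNReal.ofReal (P x ^ (b + 2) / Q x ^ (b + 1)) ∂μ := by
        refine lintegral_congr fun x => ?_
        have := hQpos x
        have := hPpos x
        rw [Pi.mul_apply, ENNReal.rpow_natCast, ← ENNReal.ofReal_pow (by positivity),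
          ← ENNReal.ofReal_mul (by positivity)]
        congr 1
        rw [div_pow, pow_succ (Q x) (b + 1)]
        field_simp
    _ ≤ ∫⁻ x, ENNReal.ofReal (S x) ∂μ :=
        lintegral_mono fun x => ENNReal.ofReal_le_ofReal (hptw x)
    _ = ENNReal.ofReal (∫ x, S x ∂μ) := by
        rw [ofReal_integral_eq_lintegral_ofReal hSint]
        refine ae_of_all _ fun x => le_trans ?_ (hptw x)
        have := hQpos x
        have := hPpos x
        simp only [Pi.zero_apply]
        positivity
    _ ≤ _ := ENNReal.ofReal_le_ofReal hSle

end GaussMix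

/-! ### Sums over subsets of fixed size. -/

section Combinatorics

variable {ι M : Type*} [DecidableEq ι] [AddCommMonoid M]

lemma sum_powersetCard_insert {i : ι} {s : Finset ι} (hi : i ∉ s) (k : ℕ) (F : Finset ι → M) :
    ∑ B ∈ Finset.powersetCard (k + 1) (insert i s), F B =
      ∑ B ∈ Finset.powersetCard (k + 1) s, F B +
        ∑ B ∈ Finset.powersetCard k s, F (insert i B) := by
  have hmem : ∀ B ∈ Finset.powersetCard k s, i ∉ B := fun B hB h =>
    hi ((Finset.mem_powersetCard.1 hB).1 h)
  rw [Finset.powersetCard_succ_insert hi, Finset.sum_union, Finset.sum_image]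
  · intro B hB B' hB' h
    rw [← Finset.erase_insert (hmem B hB), ← Finset.erase_insert (hmem B' hB')]
    exact congrArg (fun A => A.erase i) h
  · rw [Finset.disjoint_left]
    intro B hB hB'
    obtain ⟨B', _, rfl⟩ := Finset.mem_image.1 hB'
    exact hi ((Finset.mem_powersetCard.1 hB).1 (Finset.mem_insert_self _ _))

/-- Double counting: a set of size `k + 1` is `insert j B` for `k + 1` pairs `(B, j)`, one for each
of its elements. -/
lemma sum_powersetCard_sum_insert (s : Finset ι) (k : ℕ) (F : Finset ι → M) :
    ∑ p ∈ (Finset.powersetCard k s).sigma fun B => s \ B, F (insert p.2 p.1) =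
      (k + 1) • ∑ B ∈ Finset.powersetCard (k + 1) s, F B := by
  have h1 : (k + 1) • ∑ B ∈ Finset.powersetCard (k + 1) s, F B =
      ∑ p ∈ (Finset.powersetCard (k + 1) s).sigma fun B => B, F p.1 := by
    rw [Finset.sum_sigma, Finset.smul_sum]
    refine Finset.sum_congr rfl fun B hB => ?_
    simp only [Finset.sum_const, (Finset.mem_powersetCard.1 hB).2]
  rw [h1]
  refine Finset.sum_bij' (fun p _ => ⟨insert p.2 p.1, p.2⟩) (fun p _ => ⟨p.1.erase p.2, p.2⟩)
    ?_ ?_ ?_ ?_ ?_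
  · rintro ⟨B, j⟩ h
    simp only [Finset.mem_sigma, Finset.mem_powersetCard, Finset.mem_sdiff] at h ⊢
    refine ⟨⟨Finset.insert_subset h.2.1 h.1.1, ?_⟩, Finset.mem_insert_self _ _⟩
    rw [Finset.card_insert_of_notMem h.2.2, h.1.2]
  · rintro ⟨B, j⟩ h
    simp only [Finset.mem_sigma, Finset.mem_powersetCard, Finset.mem_sdiff] at h ⊢
    refine ⟨⟨(Finset.erase_subset _ _).trans h.1.1, ?_⟩, h.1.1 h.2, Finset.notMem_erase _ _⟩
    rw [Finset.card_erase_of_mem h.2, h.1.2, Nat.add_sub_cancel]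
  · rintro ⟨B, j⟩ h
    simp only [Finset.mem_sigma, Finset.mem_sdiff] at h
    simp [Finset.erase_insert h.2.2]
  · rintro ⟨B, j⟩ h
    simp only [Finset.mem_sigma] at h
    simp [Finset.insert_erase h.2]
  · rintro ⟨B, j⟩ h
    rfl

end Combinatorics

/-! ### Rescaling, shifting and thinning of two-component mixtures. -/

section Mixtures

variable {Ω : Type*} [MeasurableSpace Ω] {α : ℝ} {c : ℝ≥0∞}

lemma HolderBound.mix (hα : 1 < α) {q : ℝ} (hq : 0 ≤ q) (hq' : q ≤ 1) {P P' Q Q' : Measure Ω}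
    (h : HolderBound α c P Q) (h' : HolderBound α c P' Q') :
    HolderBound α c (ENNReal.ofReal (1 - q) • P + ENNReal.ofReal q • P')
      (ENNReal.ofReal (1 - q) • Q + ENNReal.ofReal q • Q') := by
  have := HolderBound.sum (c := c) hα (s := (Finset.univ : Finset (Fin 2)))
    (w := ![ENNReal.ofReal (1 - q), ENNReal.ofReal q]) (P := ![P, P']) (Q := ![Q, Q'])
    (by simp [← ENNReal.ofReal_add (sub_nonneg.2 hq') hq])
    (fun i _ => by fin_cases i <;> simpa)
  simpa using this

variable {E : Type*} [NormedAddCommGroup E] [InnerProductSpace ℝ E]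

/-- Replacing a clipped vector moves the sum by at most `2 * C`, that is `2 / κ` in units of the
noise; hence the `κ / 2` in `gaussEps`. -/
lemma norm_inv_smul_sub_le {s κ C : ℝ} (hs : 0 < s) (hC : 0 < C) (hκ : s / C = κ) {u v : E}
    (hu : ‖u‖ ≤ C) (hv : ‖v‖ ≤ C) : ‖s⁻¹ • u - s⁻¹ • v‖ ≤ 2 / κ := by
  rw [← smul_sub, norm_smul, norm_inv, Real.norm_of_nonneg hs.le, ← hκ]
  have := norm_sub_le u v
  calc s⁻¹ * ‖u - v‖ ≤ s⁻¹ * (2 * C) := by gcongr; linarith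
    _ = _ := by field_simp

variable [FiniteDimensional ℝ E] [MeasurableSpace E]

lemma gaussMix_eq_mix {q q' : ℝ} (hq : 0 ≤ q) (hqq' : q ≤ q') (hq' : q' ≤ 1) (hpos : 0 < q')
    (s : ℝ) (y u : E) :
    gaussMix q s y u = ENNReal.ofReal (1 - q / q') • gaussAt s y +
      ENNReal.ofReal (q / q') • gaussMix q' s y u := by
  have h1 : 0 ≤ q / q' := by positivity
  have h2 : q / q' ≤ 1 := (div_le_one hpos).2 hqq'
  rw [gaussMix, gaussMix, smul_add, smul_smul, smul_smul, ← add_assoc, ← add_smul,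
    ← ENNReal.ofReal_mul h1, ← ENNReal.ofReal_mul h1, ← ENNReal.ofReal_add (by linarith)
    (mul_nonneg h1 (by linarith))]
  congr 3 <;> field_simp
  ring

variable [BorelSpace E]

/-- Thinning: with probability `1 - q / q'` both laws are `N(y)`, otherwise they are the mixtures
with weight `q'`; quasi-convexity then applies. -/
lemma HolderBound.gaussMix_mono (hα : 1 < α) (hc : 1 ≤ c) {q q' : ℝ} (hq : 0 ≤ q) (hqq' : q ≤ q')
    (hq' : q' ≤ 1) (hpos : 0 < q') {s : ℝ} {y u u' : E}
    (h : HolderBound α c (gaussMix q' s y u) (gaussMix q' s y u')) :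
    HolderBound α c (gaussMix q s y u) (gaussMix q s y u') := by
  rw [gaussMix_eq_mix hq hqq' hq' hpos, gaussMix_eq_mix hq hqq' hq' hpos]
  exact HolderBound.mix hα (by positivity) ((div_le_one hpos).2 hqq') (HolderBound.refl hα hc) h

lemma gaussMix_eq_map_smul (q : ℝ) {s : ℝ} (hs : 0 < s) (y u : E) :
    gaussMix q s y u = (gaussMix q 1 (s⁻¹ • y) (s⁻¹ • u)).map fun w => s • w := by
  refine (map_gaussMix (by fun_prop) q (LinearIsometryEquiv.refl ℝ E) ?_ ?_).symm <;>
  · intro w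
    simp [smul_smul, mul_inv_cancel₀ hs.ne']

lemma gaussMix_add_left (q s : ℝ) (v y u : E) :
    gaussMix q s (v + y) (v + u) = (gaussMix q s y u).map fun w => v + w := by
  refine (map_gaussMix (by fun_prop) q (LinearIsometryEquiv.refl ℝ E) ?_ ?_).symm <;>
  · intro w
    simp [add_assoc]

lemma HolderBound.gaussMix_add {q s : ℝ} (v : E) {y u u' : E}
    (h : HolderBound α c (gaussMix q s y u) (gaussMix q s y u')) :
    HolderBound α c (gaussMix q s (v + y) (v + u)) (gaussMix q s (v + y) (v + u')) := by
  rw [gaussMix_add_left, gaussMix_add_left]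
  exact h.map (by fun_prop)

/-- Amplification by subsampling without replacement for two Gaussian mixtures. -/
lemma holderBound_gaussMix {a : ℕ} (ha : 2 ≤ a) {q κ C s : ℝ} (hq : 0 ≤ q) (hq' : q ≤ 1)
    (hs : 0 < s) (hC : 0 < C) (hκ : s / C = κ) {y u u' : E} (hy : ‖y‖ ≤ C) (hu : ‖u‖ ≤ C)
    (hu' : ‖u'‖ ≤ C) :
    HolderBound a (ENNReal.ofReal (subsampledGaussMoment a q κ))
      (gaussMix q s y u) (gaussMix q s y u') := by
  rw [gaussMix_eq_map_smul q hs, gaussMix_eq_map_smul q hs]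
  exact (holderBound_gaussMix_one ha hq hq' (norm_inv_smul_sub_le hs hC hκ hu hy)
    (norm_inv_smul_sub_le hs hC hκ hu' hy) (norm_inv_smul_sub_le hs hC hκ hu hu')).map
    (by fun_prop)

/-- The exact Gaussian moment, for real orders. It serves to show that the infimum in `sgmEps` runs
over a nonempty set. -/
lemma holderBound_gaussAt_one (hα : 1 < α) (u u' : E) :
    HolderBound α (ENNReal.ofReal (Real.exp (α * (α - 1) / 2 * ‖u - u'‖ ^ 2)))
      (gaussAt 1 u) (gaussAt 1 u') := by
  have hc := continuous_shiftDensity u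
  have hc' := continuous_shiftDensity u'
  have h1 : ∀ v : E, gaussAt 1 v = (stdGaussian E).withDensity fun x =>
      ENNReal.ofReal (shiftDensity v x) := fun v => by
    simp only [gaussAt, one_smul, map_add_stdGaussian]
  have hm : Measurable fun x => ENNReal.ofReal (shiftDensity u' x) := by fun_prop
  have hfm : Measurable fun x => ENNReal.ofReal (shiftDensity u x / shiftDensity u' x) := by
    have := hc.measurable
    have := hc'.measurable
    fun_prop
  have h2 : gaussAt 1 u = (gaussAt 1 u').withDensity
      fun x => ENNReal.ofReal (shiftDensity u x / shiftDensity u' x) := by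
    rw [h1, h1, ← withDensity_mul _ hm hfm]
    congr 1
    funext x
    have := shiftDensity_pos u' x
    rw [Pi.mul_apply, ← ENNReal.ofReal_mul this.le, mul_div_cancel₀ _ this.ne']
  rw [h2]
  refine holderBound_withDensity hα hfm (le_of_eq ?_)
  rw [h1, lintegral_withDensity_eq_lintegral_mul _ hm (hfm.pow_const _)]
  set k : ℝ := Real.exp (-(α * ‖u‖ ^ 2 / 2) + (α - 1) * ‖u'‖ ^ 2 / 2) with hk
  calc _ = ∫⁻ x, ENNReal.ofReal (k * Real.exp (inner ℝ (α • u - (α - 1) • u') x))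
        ∂(stdGaussian E) := by
        refine lintegral_congr fun x => ?_
        have := shiftDensity_pos u x
        have := shiftDensity_pos u' x
        rw [Pi.mul_apply, ENNReal.ofReal_rpow_of_pos (by positivity),
          ← ENNReal.ofReal_mul (by positivity)]
        congr 1
        rw [shiftDensity, shiftDensity, ← Real.exp_sub, ← Real.exp_mul, ← Real.exp_add, hk,
          ← Real.exp_add, inner_sub_left, real_inner_smul_left, real_inner_smul_left]
        congr 1
        ring
    _ = ENNReal.ofReal (∫ x, k * Real.exp (inner ℝ (α • u - (α - 1) • u') x)
        ∂(stdGaussian E)) := by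
        rw [ofReal_integral_eq_lintegral_ofReal
          ((integrable_exp_inner_stdGaussian _).const_mul _)]
        exact ae_of_all _ fun x => by simp only [Pi.zero_apply]; positivity
    _ = _ := by
        rw [integral_const_mul, integral_exp_inner_stdGaussian, hk, ← Real.exp_add]
        congr 2
        rw [@norm_sub_sq ℝ, @norm_sub_sq ℝ, norm_smul, norm_smul, real_inner_smul_left,
          real_inner_smul_right]
        simp only [Real.norm_eq_abs, mul_pow, sq_abs, RCLike.re_to_real]
        ring

/-- A bound for every order, without amplification. -/
lemma holderBound_gaussMix_of_norm_le (hα : 1 < α) {q κ C s : ℝ} (hq : 0 ≤ q) (hq' : q ≤ 1)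
    (hs : 0 < s) (hC : 0 < C) (hκ : s / C = κ) {y u u' : E} (hu : ‖u‖ ≤ C) (hu' : ‖u'‖ ≤ C) :
    HolderBound α (ENNReal.ofReal (Real.exp (α * (α - 1) / 2 * (2 / κ) ^ 2)))
      (gaussMix q s y u) (gaussMix q s y u') := by
  have hα1 : 0 < α - 1 := by linarith
  have hα0 : 0 < α := by linarith
  rw [gaussMix_eq_map_smul q hs, gaussMix_eq_map_smul q hs]
  refine HolderBound.map (by fun_prop) (HolderBound.mix hα hq hq' (HolderBound.refl hα ?_) ?_)
  · rw [ENNReal.one_le_ofReal]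
    exact Real.one_le_exp (by positivity)
  · refine (holderBound_gaussAt_one hα _ _).mono hα (ENNReal.ofReal_le_ofReal ?_)
    have := norm_inv_smul_sub_le hs hC hκ hu hu'
    gcongr

end Mixtures

/-! ### Decomposition of the subsampled Gaussian mechanism into mixtures. -/

section Subsampling

variable {E : Type*} [NormedAddCommGroup E] [InnerProductSpace ℝ E]

lemma norm_clip_le {C : ℝ} (hC : 0 ≤ C) (x : E) : ‖clip C x‖ ≤ C := by
  rw [clip, norm_smul, Real.norm_of_nonneg (le_min (by positivity) zero_le_one)]
  rcases eq_or_ne ‖x‖ 0 with h | h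
  · simp [h, hC]
  · calc min (C / ‖x‖) 1 * ‖x‖ ≤ C / ‖x‖ * ‖x‖ := by gcongr; exact min_le_left _ _
      _ = C := by field_simp

lemma clip_of_norm_le {C : ℝ} {x : E} (hx : ‖x‖ ≤ C) : clip C x = x := by
  rcases eq_or_ne ‖x‖ 0 with h | h
  · simp [clip, norm_eq_zero.1 h]
  · rw [clip, min_eq_right, one_smul]
    rwa [one_le_div (by positivity)]

variable [FiniteDimensional ℝ E] [MeasurableSpace E] [BorelSpace E] {n m : ℕ}

lemma subsampledGaussian_eq (m : ℕ) (C s : ℝ) (x : Fin n → E) :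
    subsampledGaussian m C s x = ENNReal.ofReal ((n.choose m : ℝ)⁻¹) •
      ∑ B ∈ Finset.powersetCard m Finset.univ, gaussAt s (∑ i ∈ B, clip C (x i)) := by
  rcases eq_or_ne (n.choose m) 0 with h | h
  -- For `m > n` the two prefactors differ (`∞` against `0`), but the sums are empty.
  · have : Finset.powersetCard m (Finset.univ : Finset (Fin n)) = ∅ := by
      rw [← Finset.card_eq_zero, Finset.card_powersetCard, Finset.card_fin, h]
    simp [subsampledGaussian, this]
  · rw [subsampledGaussian, Finset.smul_sum, ENNReal.ofReal_inv_of_pos (by positivity),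
      ENNReal.ofReal_natCast]
    rfl

lemma isProbabilityMeasure_subsampledGaussian (hm : m ≤ n) (C s : ℝ) (x : Fin n → E) :
    IsProbabilityMeasure (subsampledGaussian m C s x) := by
  have hpos := Nat.choose_pos hm
  constructor
  rw [subsampledGaussian_eq]
  simp only [Measure.smul_apply, Measure.finsetSum_apply, measure_univ, Finset.sum_const,
    Finset.card_powersetCard, Finset.card_fin, smul_eq_mul, nsmul_eq_mul, mul_one]
  rw [← ENNReal.ofReal_natCast, ← ENNReal.ofReal_mul (by positivity),
    inv_mul_cancel₀ (by positivity), ENNReal.ofReal_one]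

/-- The coupling by a core `p.1` and a spare index `p.2`, both avoiding `i`. There are `(n -
1).choose k * (n - 1 - k)` such pairs, and `k + 1 < n` guarantees a spare index. -/
lemma subsampledGaussian_eq_sum_gaussMix {k : ℕ} (hk : k + 1 < n) (C s : ℝ) (x : Fin n → E)
    (i : Fin n) :
    subsampledGaussian (k + 1) C s x =
      ∑ p ∈ (Finset.powersetCard k (Finset.univ.erase i)).sigma fun B => Finset.univ.erase i \ B,
        ENNReal.ofReal (((n - 1).choose k * (n - (k + 1)) : ℝ)⁻¹) •
          gaussMix ((k + 1 : ℕ) / n : ℝ) s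
            (∑ l ∈ p.1, clip C (x l) + clip C (x p.2)) (∑ l ∈ p.1, clip C (x l) + clip C (x i)) := by
  obtain ⟨N, rfl⟩ : ∃ N, n = N + 1 := ⟨n - 1, by omega⟩
  have hkN : (k : ℝ) < N := by exact_mod_cast (by omega : k < N)
  have hch : (0 : ℝ) < N.choose k := by exact_mod_cast Nat.choose_pos (by omega)
  have hch' : (0 : ℝ) < (N + 1).choose (k + 1) := by exact_mod_cast Nat.choose_pos (by omega)
  have hchoose : ((N : ℝ) + 1) * N.choose k = (N + 1).choose (k + 1) * (k + 1) := by
    exact_mod_cast Nat.add_one_mul_choose_eq N k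
  set U : Finset (Fin (N + 1)) := Finset.univ.erase i with hU
  have hUi : i ∉ U := Finset.notMem_erase _ _
  have hUcard : U.card = N := by simp [hU]
  have hins : (Finset.univ : Finset (Fin (N + 1))) = insert i U := by simp [hU]
  set F : Finset (Fin (N + 1)) → Measure E := fun B => gaussAt s (∑ l ∈ B, clip C (x l)) with hF
  set w : ℝ := (((N + 1 - 1).choose k : ℝ) * (((N + 1 : ℕ) : ℝ) - (k + 1)))⁻¹ with hw
  have hw0 : 0 ≤ w := by
    simp only [hw, Nat.add_sub_cancel]
    push_cast
    have : (0 : ℝ) ≤ N + 1 - (k + 1) := by linarith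
    positivity
  set q : ℝ := ((k + 1 : ℕ) / (N + 1 : ℕ) : ℝ) with hq
  have hq0 : 0 ≤ q := by positivity
  have hq1 : 0 ≤ 1 - q := by
    rw [hq, sub_nonneg, div_le_one (by positivity)]
    exact_mod_cast hk.le
  have hterm : ∀ p ∈ (Finset.powersetCard k U).sigma fun B => U \ B,
      ENNReal.ofReal w • gaussMix q s (∑ l ∈ p.1, clip C (x l) + clip C (x p.2))
        (∑ l ∈ p.1, clip C (x l) + clip C (x i)) =
      ENNReal.ofReal (w * (1 - q)) • F (insert p.2 p.1) +
        ENNReal.ofReal (w * q) • F (insert i p.1) := by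
    rintro ⟨B, j⟩ hp
    simp only [Finset.mem_sigma, Finset.mem_powersetCard, Finset.mem_sdiff] at hp
    have hi : i ∉ B := fun h => hUi (hp.1.1 h)
    simp only [hF, gaussMix, smul_add, smul_smul, Finset.sum_insert hp.2.2,
      Finset.sum_insert hi, ← ENNReal.ofReal_mul hw0, add_comm (clip C (x _))]
  rw [Finset.sum_congr rfl hterm, Finset.sum_add_distrib, ← Finset.smul_sum, ← Finset.smul_sum,
    sum_powersetCard_sum_insert, subsampledGaussian_eq]
  have h2 : ∑ p ∈ (Finset.powersetCard k U).sigma fun B => U \ B, F (insert i p.1) =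
      (N - k) • ∑ B ∈ Finset.powersetCard k U, F (insert i B) := by
    rw [Finset.sum_sigma, Finset.smul_sum]
    refine Finset.sum_congr rfl fun B hB => ?_
    have hB' := Finset.mem_powersetCard.1 hB
    simp only [Finset.sum_const, Finset.card_sdiff_of_subset hB'.1, hUcard, hB'.2]
  change _ • ∑ B ∈ Finset.powersetCard (k + 1) Finset.univ, F B = _
  rw [h2, hins, sum_powersetCard_insert hUi, smul_add, ← Nat.cast_smul_eq_nsmul ℝ≥0∞,
    ← Nat.cast_smul_eq_nsmul ℝ≥0∞, smul_smul, smul_smul, ← ENNReal.ofReal_natCast,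
    ← ENNReal.ofReal_natCast, ← ENNReal.ofReal_mul (mul_nonneg hw0 hq1),
    ← ENNReal.ofReal_mul (mul_nonneg hw0 hq0)]
  -- Each batch must get total weight `1 / (N + 1).choose (k + 1)`: one avoiding `i` occurs for `k +
  -- 1` pairs with weight `w * (1 - q)`, one containing `i` for `N - k` pairs with weight `w * q`.
  have hc1 : ((N + 1).choose (k + 1) : ℝ)⁻¹ = (k + 1) / ((N + 1) * N.choose k) := by
    rw [hchoose]; field_simp
  congr 3
  · rw [hc1, hw, hq]
    simp only [Nat.add_sub_cancel]
    push_cast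
    have : (N : ℝ) + 1 - (k + 1) ≠ 0 := by linarith
    field_simp
  · rw [hc1, hw, hq]
    simp only [Nat.add_sub_cancel]
    rw [Nat.cast_sub (by omega)]
    push_cast
    have : (N : ℝ) + 1 - (k + 1) ≠ 0 := by linarith
    have h3 : (N : ℝ) - k = N + 1 - (k + 1) := by ring
    rw [h3]
    field_simp

/-- Reduction of the subsampled Gaussian mechanism to pairs of two-component mixtures. -/
lemma holderBound_subsampledGaussian {α : ℝ} (hα : 1 < α) {c : ℝ≥0∞} (hc : 1 ≤ c) (hm : m ≤ n)
    {C s : ℝ} (hC : 0 ≤ C)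
    (hmix : ∀ y u u' : E, ‖y‖ ≤ C → ‖u‖ ≤ C → ‖u'‖ ≤ C →
      HolderBound α c (gaussMix (m / n : ℝ) s y u) (gaussMix (m / n : ℝ) s y u'))
    {x x' : Fin n → E} (h : ReplaceOne x x') :
    HolderBound α c (subsampledGaussian m C s x) (subsampledGaussian m C s x') := by
  obtain ⟨i, hi⟩ := h
  obtain _ | k := m
  · have : subsampledGaussian 0 C s x = subsampledGaussian 0 C s x' := by
      simp [subsampledGaussian_eq]
    rw [this]
    have := isProbabilityMeasure_subsampledGaussian hm C s x'
    exact HolderBound.refl hα hc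
  -- A full batch leaves no spare index, but then `q = 1`, so the first centre has weight zero and
  -- can be chosen equal for both datasets (`hone`).
  rcases hm.eq_or_lt with hkn | hkn
  · have hfull : ∀ z : Fin n → E, subsampledGaussian (k + 1) C s z =
        gaussMix ((k + 1 : ℕ) / n : ℝ) s
          (∑ l ∈ Finset.univ.erase i, clip C (z l) + clip C (z i))
          (∑ l ∈ Finset.univ.erase i, clip C (z l) + clip C (z i)) := by
      intro z
      have h1 : (((k + 1 : ℕ) : ℝ) / n) = 1 := by
        rw [hkn]; exact div_self (by have := i.pos; positivity)
      have h2 : Finset.powersetCard (k + 1) (Finset.univ : Finset (Fin n)) = {Finset.univ} := by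
        rw [hkn]; simpa using Finset.powersetCard_self (Finset.univ : Finset (Fin n))
      rw [subsampledGaussian_eq, h1, h2, hkn, gaussMix, Finset.sum_erase_add _ _ (Finset.mem_univ i)]
      simp
    have hone : ∀ y y' u : E, gaussMix ((k + 1 : ℕ) / n : ℝ) s y u =
        gaussMix ((k + 1 : ℕ) / n : ℝ) s y' u := by
      intro y y' u
      have h1 : (((k + 1 : ℕ) : ℝ) / n) = 1 := by
        rw [hkn]; exact div_self (by have := i.pos; positivity)
      rw [h1]
      simp [gaussMix]
    have hsum : ∑ l ∈ Finset.univ.erase i, clip C (x l) =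
        ∑ l ∈ Finset.univ.erase i, clip C (x' l) :=
      Finset.sum_congr rfl fun l hl => by rw [hi l (Finset.ne_of_mem_erase hl)]
    rw [hfull, hfull, hsum, hone _ (∑ l ∈ Finset.univ.erase i, clip C (x' l) + clip C (x' i))]
    exact (hmix _ _ _ (norm_clip_le hC _) (norm_clip_le hC _) (norm_clip_le hC _)).gaussMix_add _
  · rw [subsampledGaussian_eq_sum_gaussMix hkn C s x i,
      subsampledGaussian_eq_sum_gaussMix hkn C s x' i]
    refine HolderBound.sum hα ?_ ?_
    · rw [Finset.sum_const, Finset.card_sigma]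
      have hcard : ∀ B ∈ Finset.powersetCard k (Finset.univ.erase i),
          (Finset.univ.erase i \ B).card = n - 1 - k := fun B hB => by
        have hB' := Finset.mem_powersetCard.1 hB
        rw [Finset.card_sdiff_of_subset hB'.1, hB'.2]
        simp
      rw [Finset.sum_congr rfl hcard, Finset.sum_const, Finset.card_powersetCard]
      simp only [Finset.mem_univ, Finset.card_erase_of_mem, Finset.card_univ, Fintype.card_fin,
        smul_eq_mul, nsmul_eq_mul]
      rw [← ENNReal.ofReal_natCast, ← ENNReal.ofReal_mul (by positivity)]
      have h1 : ((n - 1 - k : ℕ) : ℝ) = n - (k + 1) := by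
        rw [Nat.sub_sub, add_comm 1 k, Nat.cast_sub hkn.le]
        push_cast
        ring
      have h2 : (0 : ℝ) < n - (k + 1) := by
        rw [← h1]; exact_mod_cast (by omega : 0 < n - 1 - k)
      have h3 : (0 : ℝ) < (n - 1).choose k := by
        exact_mod_cast Nat.choose_pos (by omega)
      rw [Nat.cast_mul, h1, mul_inv_cancel₀ (by positivity), ENNReal.ofReal_one]
    · rintro ⟨B, j⟩ hp
      simp only [Finset.mem_sigma, Finset.mem_powersetCard, Finset.mem_sdiff] at hp
      have hji : j ≠ i := Finset.ne_of_mem_erase hp.2.1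
      have hsum : ∑ l ∈ B, clip C (x l) = ∑ l ∈ B, clip C (x' l) :=
        Finset.sum_congr rfl fun l hl => by rw [hi l (Finset.ne_of_mem_erase (hp.1.1 hl))]
      simp only [hsum, hi j hji]
      exact (hmix _ _ _ (norm_clip_le hC _) (norm_clip_le hC _)
        (norm_clip_le hC _)).gaussMix_add _

/-- Each two-component mixture is a shifted output law of the mechanism. -/
lemma subsampledGaussian_ite {k : ℕ} (hk : k + 1 ≤ n) {C s : ℝ} {y u : E} (hy : ‖y‖ ≤ C)
    (hu : ‖u‖ ≤ C) (i : Fin n) :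
    subsampledGaussian (k + 1) C s (fun j => if j = i then u else y) =
      gaussMix ((k + 1 : ℕ) / n : ℝ) s ((k : ℝ) • y + y) ((k : ℝ) • y + u) := by
  obtain ⟨N, rfl⟩ : ∃ N, n = N + 1 := ⟨n - 1, by omega⟩
  set U : Finset (Fin (N + 1)) := Finset.univ.erase i with hU
  have hUi : i ∉ U := Finset.notMem_erase _ _
  have hUcard : U.card = N := by simp [hU]
  have hins : (Finset.univ : Finset (Fin (N + 1))) = insert i U := by simp [hU]
  have hchoose : ((N : ℝ) + 1) * N.choose k = (N + 1).choose (k + 1) * (k + 1) := by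
    exact_mod_cast Nat.add_one_mul_choose_eq N k
  have hpascal : ((N + 1).choose (k + 1) : ℝ) = N.choose k + N.choose (k + 1) := by
    exact_mod_cast Nat.choose_succ_succ N k
  have hch : (0 : ℝ) < N.choose k := by exact_mod_cast Nat.choose_pos (by omega)
  have hch' : (0 : ℝ) < (N + 1).choose (k + 1) := by exact_mod_cast Nat.choose_pos (by omega)
  have hsumB : ∀ B ⊆ U, ∑ l ∈ B, clip C (if l = i then u else y) = (B.card : ℝ) • y := by
    intro B hB
    rw [Nat.cast_smul_eq_nsmul ℝ, ← Finset.sum_const]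
    refine Finset.sum_congr rfl fun l hl => ?_
    rw [if_neg (Finset.ne_of_mem_erase (hB hl)), clip_of_norm_le hy]
  rw [subsampledGaussian_eq, hins, sum_powersetCard_insert hUi]
  have h1 : ∀ B ∈ Finset.powersetCard (k + 1) U,
      gaussAt s (∑ l ∈ B, clip C (if l = i then u else y)) = gaussAt s ((k : ℝ) • y + y) := by
    intro B hB
    have hB' := Finset.mem_powersetCard.1 hB
    rw [hsumB B hB'.1, hB'.2]
    push_cast
    rw [add_smul, one_smul]
  have h2 : ∀ B ∈ Finset.powersetCard k U,
      gaussAt s (∑ l ∈ insert i B, clip C (if l = i then u else y)) =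
        gaussAt s ((k : ℝ) • y + u) := by
    intro B hB
    have hB' := Finset.mem_powersetCard.1 hB
    rw [Finset.sum_insert fun h => hUi (hB'.1 h), hsumB B hB'.1, hB'.2, if_pos rfl,
      clip_of_norm_le hu, add_comm]
  rw [Finset.sum_congr rfl h1, Finset.sum_congr rfl h2, Finset.sum_const, Finset.sum_const,
    Finset.card_powersetCard, Finset.card_powersetCard, hUcard, gaussMix, smul_add,
    ← Nat.cast_smul_eq_nsmul ℝ≥0∞, ← Nat.cast_smul_eq_nsmul ℝ≥0∞, smul_smul, smul_smul,
    ← ENNReal.ofReal_natCast, ← ENNReal.ofReal_natCast, ← ENNReal.ofReal_mul (by positivity),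
    ← ENNReal.ofReal_mul (by positivity)]
  have hq : (((k + 1 : ℕ) : ℝ) / (N + 1 : ℕ)) = ((N + 1).choose (k + 1) : ℝ)⁻¹ * N.choose k := by
    push_cast
    field_simp
    linarith
  have hq' : 1 - (((k + 1 : ℕ) : ℝ) / (N + 1 : ℕ)) =
      ((N + 1).choose (k + 1) : ℝ)⁻¹ * N.choose (k + 1) := by
    rw [hq, eq_sub_of_add_eq' hpascal.symm]
    field_simp
  rw [hq', hq]

lemma map_subsampledGaussian {F : Type*} [NormedAddCommGroup F] [InnerProductSpace ℝ F]
    [FiniteDimensional ℝ F] [MeasurableSpace F] [BorelSpace F] (g : E ≃ₗᵢ[ℝ] F) (m : ℕ) (C s : ℝ)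
    (x : Fin n → E) :
    (subsampledGaussian m C s x).map g = subsampledGaussian m C s fun i => g (x i) := by
  have hg : Measurable g := g.continuous.measurable
  rw [subsampledGaussian_eq, subsampledGaussian_eq, Measure.map_smul,
    Measure.map_finset_sum hg.aemeasurable]
  congr 1
  refine Finset.sum_congr rfl fun B _ => ?_
  refine map_gaussAt hg g fun w => ?_
  simp [clip, map_sum]

end Subsampling

/-! ### Both versions of `ε_α(γ, κ)` satisfy the required properties. -/

section Amplification

/-- The properties of `ε_α(γ, κ)` which the privacy analysis uses. -/
structure IsAmplificationBound (α : ℝ) (ε : ℝ → ℝ → ℝ) : Prop where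
  nonneg : ∀ {γ κ : ℝ}, 0 ≤ γ → 0 < κ → 0 ≤ ε γ κ
  mono : ∀ {γ γ' κ : ℝ}, 0 ≤ γ → γ ≤ γ' → γ' ≤ 1 → 0 < κ → ε γ κ ≤ ε γ' κ
  bound : ∀ {γ κ : ℝ}, 0 ≤ γ → γ ≤ 1 → 0 < κ → ∀ {d n : ℕ} {C s : ℝ}, 0 < C → s / C = κ →
    ∀ {x x' : Fin n → EuclideanSpace ℝ (Fin d)}, ReplaceOne x x' →
      HolderBound α (ENNReal.ofReal (Real.exp ((α - 1) * ε γ κ)))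
        (subsampledGaussian ⌊γ * n⌋₊ C s x) (subsampledGaussian ⌊γ * n⌋₊ C s x')

lemma floor_mul_le {γ : ℝ} (hγ' : γ ≤ 1) (n : ℕ) : ⌊γ * n⌋₊ ≤ n :=
  Nat.floor_le_of_le (by nlinarith [(Nat.cast_nonneg n : (0 : ℝ) ≤ n)])

lemma floor_mul_div_le {γ : ℝ} (hγ : 0 ≤ γ) (n : ℕ) : (⌊γ * n⌋₊ / n : ℝ) ≤ γ := by
  rcases n.eq_zero_or_pos with rfl | hn
  · simpa
  · rw [div_le_iff₀ (by positivity)]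
    exact Nat.floor_le (by positivity)

lemma one_le_ofReal_exp {α ε : ℝ} (hα : 1 < α) (hε : 0 ≤ ε) :
    1 ≤ ENNReal.ofReal (Real.exp ((α - 1) * ε)) := by
  rw [ENNReal.one_le_ofReal]
  exact Real.one_le_exp (mul_nonneg (by linarith) hε)

lemma exp_mul_subsampledGaussEps {a : ℕ} (ha : 1 < (a : ℝ)) {γ : ℝ} (hγ : 0 ≤ γ) (κ : ℝ) :
    Real.exp (((a : ℝ) - 1) * subsampledGaussEps a γ κ) = subsampledGaussMoment a γ κ := by
  have h1 : subsampledGaussEps a γ κ =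
    1 / ((a : ℝ) - 1) * Real.log (subsampledGaussMoment a γ κ) := rfl
  have h2 : (a : ℝ) - 1 ≠ 0 := by linarith
  rw [h1, ← mul_assoc, mul_one_div_cancel h2, one_mul,
    Real.exp_log (by linarith [one_le_subsampledGaussMoment a hγ κ])]

lemma isAmplificationBound_subsampledGaussEps {a : ℕ} (ha : 1 < (a : ℝ)) :
    IsAmplificationBound a (subsampledGaussEps a) where
  nonneg := fun {γ κ} hγ hκ => by
    have h1 : subsampledGaussEps a γ κ =
      1 / ((a : ℝ) - 1) * Real.log (subsampledGaussMoment a γ κ) := rfl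
    rw [h1]
    exact mul_nonneg (one_div_nonneg.2 (by linarith))
      (Real.log_nonneg (one_le_subsampledGaussMoment a hγ κ))
  mono := fun {γ γ' κ} hγ hγγ' _ hκ => by
    have h1 : ∀ γ, subsampledGaussEps a γ κ =
      1 / ((a : ℝ) - 1) * Real.log (subsampledGaussMoment a γ κ) := fun _ => rfl
    rw [h1, h1]
    have := one_le_subsampledGaussMoment a hγ κ
    have := one_div_nonneg.2 (by linarith : 0 ≤ (a : ℝ) - 1)
    gcongr
    exact subsampledGaussMoment_mono a hγ hγγ' κ
  bound := fun {γ κ} hγ hγ' hκ d n C s hC hs x x' h => by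
    have hs0 : 0 < s := by
      rw [div_eq_iff hC.ne'] at hs
      rw [hs]; positivity
    have ha2 : 2 ≤ a := by exact_mod_cast (by exact_mod_cast ha : 1 < a)
    -- The effective rate `⌊γ n⌋ / n` may be smaller than `γ`; monotonicity of the moment absorbs
    -- the rounding.
    have hle := floor_mul_div_le hγ n
    have hq0 : (0 : ℝ) ≤ ⌊γ * n⌋₊ / n := by positivity
    rw [exp_mul_subsampledGaussEps ha hγ]
    refine holderBound_subsampledGaussian ha ?_ (floor_mul_le hγ' n) hC.le ?_ h
    · rw [ENNReal.one_le_ofReal]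
      exact one_le_subsampledGaussMoment a hγ κ
    · intro y u u' hy hu hu'
      exact (holderBound_gaussMix ha2 hq0 (hle.trans hγ') hs0 hC hs hy hu hu').mono ha
        (ENNReal.ofReal_le_ofReal (subsampledGaussMoment_mono a hq0 hle κ))

lemma isRDP_subsampledGaussian_iff {α : ℝ} (hα : 1 < α) {d n m : ℕ} (hm : m ≤ n) {C s ε : ℝ} :
    IsRDP α (ReplaceOne (n := n))
      (subsampledGaussian (E := EuclideanSpace ℝ (Fin d)) m C s) ε ↔
    ∀ x x' : Fin n → EuclideanSpace ℝ (Fin d), ReplaceOne x x' →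
      HolderBound α (ENNReal.ofReal (Real.exp ((α - 1) * ε)))
        (subsampledGaussian m C s x) (subsampledGaussian m C s x') := by
  have hp := fun x : Fin n → EuclideanSpace ℝ (Fin d) =>
    isProbabilityMeasure_subsampledGaussian hm C s x
  simp only [IsRDP, hp, implies_true, true_and, renyiDiv_le_iff hα]

/-- The infimum is attained because upper bounds on divergences pass to the limit. Nonemptiness
matters, since `sInf ∅ = 0`. -/
lemma sgmEps_mem {α γ κ : ℝ} (hα : 1 < α) (hγ : 0 ≤ γ) (hγ' : γ ≤ 1) (hκ : 0 < κ) :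
    sgmEps α γ κ ∈ {ε : ℝ | 0 ≤ ε ∧ ∀ (d n : ℕ) (C s : ℝ), 0 < C → s / C = κ →
      IsRDP α (ReplaceOne (n := n))
        (subsampledGaussian (E := EuclideanSpace ℝ (Fin d)) ⌊γ * n⌋₊ C s) ε} := by
  set S := {ε : ℝ | 0 ≤ ε ∧ ∀ (d n : ℕ) (C s : ℝ), 0 < C → s / C = κ →
      IsRDP α (ReplaceOne (n := n))
        (subsampledGaussian (E := EuclideanSpace ℝ (Fin d)) ⌊γ * n⌋₊ C s) ε} with hS
  have hne : S.Nonempty := by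
    have h0 : 0 ≤ α / 2 * (2 / κ) ^ 2 := by positivity
    -- The guarantee of the Gaussian mechanism without amplification.
    refine ⟨α / 2 * (2 / κ) ^ 2, h0, fun d n C s hC hs => ?_⟩
    have hs0 : 0 < s := by
      rw [div_eq_iff hC.ne'] at hs
      rw [hs]; positivity
    rw [isRDP_subsampledGaussian_iff hα (floor_mul_le hγ' n)]
    intro x x' h
    refine holderBound_subsampledGaussian hα (one_le_ofReal_exp hα h0) (floor_mul_le hγ' n)
      hC.le ?_ h
    intro y u u' hy hu hu'
    rw [show (α - 1) * (α / 2 * (2 / κ) ^ 2) = α * (α - 1) / 2 * (2 / κ) ^ 2 by ring]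
    exact holderBound_gaussMix_of_norm_le hα (by positivity)
      ((floor_mul_div_le hγ n).trans hγ') hs0 hC hs hu hu'
  have hbdd : BddBelow S := ⟨0, fun ε hε => hε.1⟩
  refine ⟨Real.sInf_nonneg fun ε hε => hε.1, fun d n C s hC hs => ?_⟩
  obtain ⟨ε₀, hε₀⟩ := hne
  refine ⟨(hε₀.2 d n C s hC hs).1, fun x x' h => ?_⟩
  refine EReal.le_of_forall_lt_iff_le.1 fun z hz => ?_
  obtain ⟨ε, hε, hεz⟩ := (csInf_lt_iff hbdd ⟨ε₀, hε₀⟩).1 (EReal.coe_lt_coe_iff.1 hz)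
  exact ((hε.2 d n C s hC hs).2 x x' h).trans (EReal.coe_le_coe_iff.2 hεz.le)

/-- The optimal bound at rate `γ'` controls all pairs of mixtures with weight `⌊γ' n⌋ / n`, as these
are realized by actual datasets. Thinning passes to weight `⌊γ n⌋ / n`, and mixtures control the
mechanism. -/
lemma sgmEps_mono {α γ γ' κ : ℝ} (hα : 1 < α) (hγ : 0 ≤ γ) (hγγ' : γ ≤ γ') (hγ' : γ' ≤ 1)
    (hκ : 0 < κ) : sgmEps α γ κ ≤ sgmEps α γ' κ := by
  obtain ⟨h0, hmem⟩ := sgmEps_mem hα (hγ.trans hγγ') hγ' hκ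
  refine csInf_le ⟨0, fun ε hε => hε.1⟩ ⟨h0, fun d n C s hC hs => ?_⟩
  have hmem' := (isRDP_subsampledGaussian_iff hα (floor_mul_le hγ' n)).1 (hmem d n C s hC hs)
  have hc := one_le_ofReal_exp hα h0
  have hle : ⌊γ * n⌋₊ ≤ ⌊γ' * n⌋₊ := by gcongr
  rw [isRDP_subsampledGaussian_iff hα (floor_mul_le (hγγ'.trans hγ') n)]
  intro x x' h
  refine holderBound_subsampledGaussian hα hc (floor_mul_le (hγγ'.trans hγ') n) hC.le ?_ h
  intro y u u' hy hu hu'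
  obtain ⟨i, -⟩ := h
  have hn : (0 : ℝ) < n := by exact_mod_cast i.pos
  rcases Nat.eq_zero_or_pos ⌊γ' * n⌋₊ with hz | hpos
  · have hz' : ⌊γ * n⌋₊ = 0 := by omega
    rw [hz']
    simpa [gaussMix] using HolderBound.refl hα hc (P := gaussAt s y)
  · refine HolderBound.gaussMix_mono hα hc (by positivity)
      (q' := (⌊γ' * n⌋₊ / n : ℝ)) (by gcongr) ((floor_mul_div_le (hγ.trans hγγ') n).trans hγ')
      (by positivity) ?_
    have hmn := floor_mul_le hγ' n
    obtain ⟨k, hk⟩ : ∃ k, ⌊γ' * n⌋₊ = k + 1 := ⟨⌊γ' * n⌋₊ - 1, by omega⟩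
    -- With all other entries equal to `y`, the output is the desired mixture shifted by `k • y`;
    -- the shift is undone at the end.
    have := hmem' (fun j => if j = i then u else y) (fun j => if j = i then u' else y)
      ⟨i, fun j hj => by simp [hj]⟩
    rw [hk] at this hmn ⊢
    rw [subsampledGaussian_ite hmn hy hu i, subsampledGaussian_ite hmn hy hu' i] at this
    simpa using this.gaussMix_add (-((k : ℝ) • y))

lemma isAmplificationBound_sgmEps {α : ℝ} (hα : 1 < α) : IsAmplificationBound α (sgmEps α) where
  nonneg := fun _ _ => Real.sInf_nonneg fun _ hε => hε.1
  mono := sgmEps_mono hα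
  bound := fun hγ hγ' hκ d n C s hC hs x x' h =>
    (isRDP_subsampledGaussian_iff hα (floor_mul_le hγ' n)).1
      ((sgmEps_mem hα hγ hγ' hκ).2 d n C s hC hs) x x' h

/-- The bound holds in every finite-dimensional space. -/
lemma IsAmplificationBound.holderBound {α : ℝ} {ε : ℝ → ℝ → ℝ} (hε : IsAmplificationBound α ε)
    {γ κ : ℝ} (hγ : 0 ≤ γ) (hγ' : γ ≤ 1) (hκ : 0 < κ)
    {E : Type*} [NormedAddCommGroup E] [InnerProductSpace ℝ E] [FiniteDimensional ℝ E]
    [MeasurableSpace E] [BorelSpace E] {n : ℕ} {C s : ℝ} (hC : 0 < C) (hs : s / C = κ)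
    {x x' : Fin n → E} (h : ReplaceOne x x') :
    HolderBound α (ENNReal.ofReal (Real.exp ((α - 1) * ε γ κ)))
      (subsampledGaussian ⌊γ * n⌋₊ C s x) (subsampledGaussian ⌊γ * n⌋₊ C s x') := by
  set g := (stdOrthonormalBasis ℝ E).repr
  have h1 : ∀ z : Fin n → E, subsampledGaussian ⌊γ * n⌋₊ C s z =
      (subsampledGaussian ⌊γ * n⌋₊ C s fun i => g (z i)).map g.symm := by
    intro z
    rw [map_subsampledGaussian]
    simp
  rw [h1 x, h1 x']
  refine (hε.bound hγ hγ' hκ hC hs ?_).map g.symm.continuous.measurable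
  obtain ⟨i, hi⟩ := h
  exact ⟨i, fun j hj => by simp only [hi j hj]⟩

end Amplification

/-! ### Measurability of the transition kernels, required for composition. -/

section Measurability

variable {X Y W : Type*} [MeasurableSpace X] [MeasurableSpace Y] [MeasurableSpace W]

lemma measurable_map_param {κ : X → Measure Y} (hκ : Measurable κ)
    [∀ x, IsProbabilityMeasure (κ x)] {F : X → Y → W} (hF : Measurable (Function.uncurry F)) :
    Measurable fun x => (κ x).map (F x) := by
  let K : Kernel X Y := ⟨κ, hκ⟩
  have : IsMarkovKernel K := ⟨fun x => inferInstanceAs (IsProbabilityMeasure (κ x))⟩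
  refine Measure.measurable_of_measurable_coe _ fun s hs => ?_
  have h1 : ∀ x, (κ x).map (F x) s = K x (Prod.mk x ⁻¹' (Function.uncurry F ⁻¹' s)) := fun x =>
    Measure.map_apply (hF.comp measurable_prodMk_left) hs
  simp_rw [h1]
  exact Kernel.measurable_kernel_prodMk_left (hF hs)

lemma measurable_prod_measure {κ : X → Measure Y} {η : X → Measure W} (hκ : Measurable κ)
    (hη : Measurable η) [∀ x, IsProbabilityMeasure (κ x)] [∀ x, IsProbabilityMeasure (η x)] :
    Measurable fun x => (κ x).prod (η x) := by
  let K : Kernel X Y := ⟨κ, hκ⟩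
  let H : Kernel X W := ⟨η, hη⟩
  have : IsMarkovKernel K := ⟨fun x => inferInstanceAs (IsProbabilityMeasure (κ x))⟩
  have : IsMarkovKernel H := ⟨fun x => inferInstanceAs (IsProbabilityMeasure (η x))⟩
  have h1 : (fun x => (κ x).prod (η x)) = fun x => (K ×ₖ H) x := by
    funext x
    rw [Kernel.prod_apply]
    rfl
  rw [h1]
  exact Kernel.measurable _

lemma measurable_pi_measure {ι : Type*} [Fintype ι] {Y : ι → Type*} [∀ i, MeasurableSpace (Y i)]
    {κ : ∀ i, X → Measure (Y i)} (hκ : ∀ i, Measurable (κ i))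
    [∀ i x, IsProbabilityMeasure (κ i x)] :
    Measurable fun x => Measure.pi fun i => κ i x := by
  refine Measurable.measure_of_isPiSystem_of_isProbabilityMeasure generateFrom_pi.symm
    isPiSystem_pi ?_
  rintro _ ⟨s, hs, rfl⟩
  simp only [Measure.pi_pi]
  exact Finset.measurable_prod _ fun i _ =>
    (Measure.measurable_coe (hs i (Set.mem_univ i))).comp (hκ i)

lemma measurable_sum_smul_measure {ι : Type*} {s : Finset ι} {w : ι → X → ℝ≥0∞}
    {κ : ι → X → Measure Y} (hw : ∀ i ∈ s, Measurable (w i)) (hκ : ∀ i ∈ s, Measurable (κ i)) :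
    Measurable fun x => ∑ i ∈ s, w i x • κ i x := by
  refine Measure.measurable_of_measurable_coe _ fun t ht => ?_
  simp only [Measure.finsetSum_apply, Measure.smul_apply, smul_eq_mul]
  exact Finset.measurable_sum _ fun i hi =>
    (hw i hi).mul ((Measure.measurable_coe ht).comp (hκ i hi))

variable {E : Type*} [NormedAddCommGroup E] [InnerProductSpace ℝ E] [FiniteDimensional ℝ E]
  [MeasurableSpace E] [BorelSpace E]

lemma measurable_clip (C : ℝ) : Measurable (clip C : E → E) := by
  unfold clip
  exact ((measurable_const.div measurable_norm).min measurable_const).smul measurable_id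

lemma measurable_subsampledGaussian {n : ℕ} (m : ℕ) (C s : ℝ) {f : Fin n → X → E}
    (hf : ∀ i, Measurable (f i)) :
    Measurable fun x => subsampledGaussian m C s fun i => f i x := by
  refine measurable_sum_smul_measure (fun _ _ => measurable_const) fun B _ => ?_
  refine measurable_map_param (κ := fun _ : X => stdGaussian E) measurable_const ?_
  refine Measurable.add ?_ (measurable_snd.const_smul s)
  exact Finset.measurable_sum _ fun i _ => (measurable_clip C).comp ((hf i).comp measurable_fst)

/-- Derivatives are measurable for arbitrary `f`, so the losses need no smoothness. -/
lemma measurable_gradient (f : E → ℝ) : Measurable (gradient f) :=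
  (InnerProductSpace.toDual ℝ E).symm.continuous.measurable.comp (measurable_fderiv ℝ f)

end Measurability

/-! ### Privacy of one iteration and of the whole algorithm. -/

section Algorithm

variable {Z : Type*} {d G : ℕ} {n : Fin G → ℕ} {h : Hyper} {m : Fin G → ℕ}
  {loss : Z → EuclideanSpace ℝ (Fin d) → ℝ} {init : Measure (EuclideanSpace ℝ (Fin d))}

lemma measurable_weight (g : Fin G) : Measurable fun S : State d G => S.2.1 g :=
  (measurable_pi_apply g).comp (measurable_subtype_coe.comp measurable_snd)

lemma measurable_expReweight (β : ℝ) :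
    Measurable fun p : State d G × (Fin G → ℝ) => expReweight β p.1.2 p.2 := by
  have h1 : ∀ g, Measurable fun p : State d G × (Fin G → ℝ) =>
      p.1.2.1 g * Real.exp (β * p.2 g) := fun g =>
    ((measurable_weight g).comp measurable_fst).mul
      (Real.measurable_exp.comp
        ((measurable_const_mul β).comp ((measurable_pi_apply g).comp measurable_snd)))
  exact Measurable.subtype_mk (measurable_pi_lambda _ fun g =>
    (h1 g).div (Finset.measurable_sum _ fun g' _ => h1 g'))

lemma sum_ofReal_weights (w : stdSimplex ℝ (Fin G)) : ∑ g, ENNReal.ofReal (w.1 g) = 1 := by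
  rw [← ENNReal.ofReal_sum_of_nonneg fun g _ => w.2.1 g, w.2.2, ENNReal.ofReal_one]

lemma isProbabilityMeasure_sum_smul {ι Ω : Type*} [MeasurableSpace Ω] {s : Finset ι}
    {w : ι → ℝ≥0∞} {P : ι → Measure Ω} (hw : ∑ i ∈ s, w i = 1)
    (hP : ∀ i ∈ s, IsProbabilityMeasure (P i)) : IsProbabilityMeasure (∑ i ∈ s, w i • P i) := by
  constructor
  simp only [Measure.finsetSum_apply, Measure.smul_apply, smul_eq_mul]
  rw [← hw]
  exact Finset.sum_congr rfl fun i hi => by rw [(hP i hi).measure_univ, mul_one]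

lemma isProbabilityMeasure_modelUpdate (hm : ∀ g, m g ≤ n g) (D : GroupDataset n Z)
    (S : State d G) : IsProbabilityMeasure (modelUpdate h m loss D S) := by
  refine isProbabilityMeasure_sum_smul (sum_ofReal_weights S.2) fun g _ => ?_
  have := isProbabilityMeasure_subsampledGaussian (hm g) h.ξ h.σ
    fun i => gradient (loss (D g i)) S.1
  exact Measure.isProbabilityMeasure_map (by fun_prop)

lemma measurable_modelUpdate (hm : ∀ g, m g ≤ n g) (D : GroupDataset n Z) :
    Measurable (modelUpdate h m loss D) := by
  refine measurable_sum_smul_measure (fun g _ => (measurable_weight g).ennreal_ofReal)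
    fun g _ => ?_
  have := fun S : State d G => isProbabilityMeasure_subsampledGaussian (hm g) h.ξ h.σ
    fun i => gradient (loss (D g i)) S.1
  exact measurable_map_param (κ := fun S : State d G => subsampledGaussian (m g) h.ξ h.σ
      fun i => gradient (loss (D g i)) S.1)
    (measurable_subsampledGaussian (m g) h.ξ h.σ fun i =>
      (measurable_gradient (loss (D g i))).comp measurable_fst)
    ((measurable_fst.comp measurable_fst).sub
      ((measurable_const_smul (h.η / (m g : ℝ))).comp measurable_snd))

lemma isProbabilityMeasure_lossRelease (hγ' : h.γ ≤ 1) (D : GroupDataset n Z) (g : Fin G)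
    (S : State d G) : IsProbabilityMeasure
      ((subsampledGaussian ⌊h.γ * n g⌋₊ h.ζ h.τ (fun i => loss (D g i) S.1)).map
        fun v => 1 / (⌊h.γ * n g⌋₊ : ℝ) * v) := by
  have := isProbabilityMeasure_subsampledGaussian (floor_mul_le hγ' (n g)) h.ζ h.τ
    fun i => loss (D g i) S.1
  exact Measure.isProbabilityMeasure_map (by fun_prop)

lemma isProbabilityMeasure_weightUpdate (hγ' : h.γ ≤ 1) (D : GroupDataset n Z) (S : State d G) :
    IsProbabilityMeasure (weightUpdate h loss D S) := by
  have := isProbabilityMeasure_lossRelease (loss := loss) hγ' D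
  exact Measure.isProbabilityMeasure_map
    ((measurable_expReweight h.β).comp (measurable_prodMk_left (x := S))).aemeasurable

lemma measurable_weightUpdate (hloss : ∀ z, Measurable (loss z)) (hγ' : h.γ ≤ 1)
    (D : GroupDataset n Z) : Measurable (weightUpdate h loss D : State d G → _) := by
  have := isProbabilityMeasure_lossRelease (loss := loss) hγ' D
  refine measurable_map_param (measurable_pi_measure fun g => ?_) (measurable_expReweight h.β)
  exact (Measure.measurable_map _ (by fun_prop)).comp (measurable_subsampledGaussian _ _ _ fun i =>
    (hloss (D g i)).comp measurable_fst)

lemma isProbabilityMeasure_step (hm : ∀ g, m g ≤ n g) (hγ' : h.γ ≤ 1) (D : GroupDataset n Z)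
    (t : ℕ) (S : State d G) : IsProbabilityMeasure (step h m loss D t S) := by
  have := isProbabilityMeasure_modelUpdate (h := h) (loss := loss) hm D S
  have := isProbabilityMeasure_weightUpdate (loss := loss) hγ' D S
  unfold step
  split_ifs <;> infer_instance

lemma measurable_step (hloss : ∀ z, Measurable (loss z)) (hm : ∀ g, m g ≤ n g) (hγ' : h.γ ≤ 1)
    (D : GroupDataset n Z) (t : ℕ) : Measurable (step h m loss D t : State d G → _) := by
  have := isProbabilityMeasure_modelUpdate (h := h) (loss := loss) hm D
  have := isProbabilityMeasure_weightUpdate (loss := loss) hγ' D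
  unfold step
  split_ifs
  · exact measurable_prod_measure (measurable_modelUpdate hm D)
      (measurable_weightUpdate hloss hγ' D)
  · exact measurable_prod_measure (measurable_modelUpdate hm D)
      (Measure.measurable_dirac.comp measurable_snd)

lemma isProbabilityMeasure_stateLaw [NeZero G] [IsProbabilityMeasure init]
    (hloss : ∀ z, Measurable (loss z)) (hm : ∀ g, m g ≤ n g) (hγ' : h.γ ≤ 1)
    (D : GroupDataset n Z) (t : ℕ) : IsProbabilityMeasure (stateLaw h m loss init D t) := by
  induction t with
  | zero => unfold stateLaw; infer_instance
  | succ t ih =>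
    unfold stateLaw
    exact isProbabilityMeasure_bind (measurable_step hloss hm hγ' D (t + 1)).aemeasurable
      (ae_of_all _ (isProbabilityMeasure_step hm hγ' D (t + 1)))

variable {α : ℝ} {a b : ℝ≥0∞} {g : Fin G} {D D' : GroupDataset n Z}

/-- Given the state, the group is drawn with the same probabilities for both datasets, and only
component `g` of the mixture differs; quasi-convexity keeps its constant. -/
lemma holderBound_modelUpdate (hα : 1 < α) (ha : 1 ≤ a) (hm : ∀ g, m g ≤ n g)
    (hD : NeighborsIn g D D')
    (hmodel : ∀ x x' : Fin (n g) → EuclideanSpace ℝ (Fin d), ReplaceOne x x' →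
      HolderBound α a (subsampledGaussian (m g) h.ξ h.σ x) (subsampledGaussian (m g) h.ξ h.σ x'))
    (S : State d G) :
    HolderBound α a (modelUpdate h m loss D S) (modelUpdate h m loss D' S) := by
  refine HolderBound.sum hα (sum_ofReal_weights S.2) fun g' _ => HolderBound.map (by fun_prop) ?_
  by_cases hg : g' = g
  · subst hg
    obtain ⟨i, hi⟩ := hD.1
    exact hmodel _ _ ⟨i, fun j hj => by simp only [hi j hj]⟩
  · rw [hD.2 g' hg]
    have := isProbabilityMeasure_subsampledGaussian (hm g') h.ξ h.σ
      fun i => gradient (loss (D' g' i)) S.1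
    exact HolderBound.refl hα ha

/-- Only the loss release of group `g` differs, so a single factor is charged; the reweighting is
post-processing. -/
lemma holderBound_weightUpdate (hα : 1 < α) (hγ' : h.γ ≤ 1) (hD : NeighborsIn g D D')
    (hweight : ∀ x x' : Fin (n g) → ℝ, ReplaceOne x x' →
      HolderBound α b (subsampledGaussian ⌊h.γ * n g⌋₊ h.ζ h.τ x)
        (subsampledGaussian ⌊h.γ * n g⌋₊ h.ζ h.τ x'))
    (S : State d G) :
    HolderBound α b (weightUpdate h loss D S) (weightUpdate h loss D' S) := by
  have := isProbabilityMeasure_lossRelease (loss := loss) hγ' D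
  have := isProbabilityMeasure_lossRelease (loss := loss) hγ' D'
  refine HolderBound.map ((measurable_expReweight h.β).comp (measurable_prodMk_left (x := S))) ?_
  refine HolderBound.pi hα g (fun g' hg => by rw [hD.2 g' hg]) (HolderBound.map (by fun_prop) ?_)
  obtain ⟨i, hi⟩ := hD.1
  exact hweight _ _ ⟨i, fun j hj => by simp only [hi j hj]⟩

/-- Adaptive composition over the iterations. -/
lemma holderBound_stateLaw [NeZero G] [IsProbabilityMeasure init] (hα : 1 < α) (ha : 1 ≤ a)
    (hloss : ∀ z, Measurable (loss z)) (hm : ∀ g, m g ≤ n g) (hγ' : h.γ ≤ 1)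
    (hD : NeighborsIn g D D')
    (hmodel : ∀ x x' : Fin (n g) → EuclideanSpace ℝ (Fin d), ReplaceOne x x' →
      HolderBound α a (subsampledGaussian (m g) h.ξ h.σ x) (subsampledGaussian (m g) h.ξ h.σ x'))
    (hweight : ∀ x x' : Fin (n g) → ℝ, ReplaceOne x x' →
      HolderBound α b (subsampledGaussian ⌊h.γ * n g⌋₊ h.ζ h.τ x)
        (subsampledGaussian ⌊h.γ * n g⌋₊ h.ζ h.τ x')) (t : ℕ) :
    HolderBound α (a ^ t * b ^ (t / h.k)) (stateLaw h m loss init D t)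
      (stateLaw h m loss init D' t) := by
  induction t with
  | zero =>
    simp only [stateLaw, pow_zero, Nat.zero_div, mul_one]
    exact HolderBound.refl hα le_rfl
  | succ t ih =>
    have hstep : ∀ S, HolderBound α (a * if h.k ∣ t + 1 then b else 1)
        (step h m loss D (t + 1) S) (step h m loss D' (t + 1) S) := by
      intro S
      have := isProbabilityMeasure_weightUpdate (loss := loss) hγ' D S
      have := isProbabilityMeasure_weightUpdate (loss := loss) hγ' D' S
      have hmod := holderBound_modelUpdate (loss := loss) hα ha hm hD hmodel S
      simp only [step, Nat.dvd_iff_mod_eq_zero]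
      split_ifs
      · exact hmod.prod hα (holderBound_weightUpdate hα hγ' hD hweight S)
      · exact hmod.prod hα (HolderBound.refl hα le_rfl)
    have := ih.bind hα (measurable_step hloss hm hγ' D (t + 1))
      (measurable_step hloss hm hγ' D' (t + 1)) hstep
    simp only [stateLaw]
    convert this using 1
    -- The quotient `t / k` grows by one exactly when `k ∣ t + 1`, that is, when the weights are
    -- updated.
    rw [Nat.succ_div]
    split_ifs <;> ring

/-- The rate `γ` only has to reproduce the batch size of group `g` after rounding down. This allows
`M / n g` for aZB and the common rate `M / ∑ g, n g` for aZB-prop. -/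
lemma isRDP_groupDRO [NeZero G] [IsProbabilityMeasure init] {ε : ℝ → ℝ → ℝ} (hα : 1 < α)
    (hε : IsAmplificationBound α ε) (hloss : ∀ z, Measurable (loss z)) (hξ : 0 < h.ξ)
    (hσ : 0 < h.σ) (hζ : 0 < h.ζ) (hτ : 0 < h.τ) (hγ : 0 ≤ h.γ) (hγ' : h.γ ≤ 1)
    (hm : ∀ g, m g ≤ n g) {γ : ℝ} (h0 : 0 ≤ γ) (h1 : γ ≤ 1) (g : Fin G)
    (hmg : m g = ⌊γ * n g⌋₊) :
    IsRDP α (NeighborsIn g) (groupDRO (n := n) h m loss init)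
      (h.T * ε γ (h.σ / h.ξ) + (h.T / h.k : ℕ) * ε h.γ (h.τ / h.ζ)) := by
  have hprob : ∀ D : GroupDataset n Z, IsProbabilityMeasure (groupDRO h m loss init D) := by
    intro D
    have := isProbabilityMeasure_stateLaw (init := init) hloss hm hγ' D h.T
    exact Measure.isProbabilityMeasure_map measurable_fst.aemeasurable
  refine ⟨hprob, fun D D' hD => (renyiDiv_le_iff hα).2 ?_⟩
  have hκ : 0 < h.σ / h.ξ := by positivity
  have hκ' : 0 < h.τ / h.ζ := by positivity
  have key := (holderBound_stateLaw (init := init) hα (one_le_ofReal_exp hα (hε.nonneg h0 hκ))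
    hloss hm hγ' hD
    (fun x x' hx => by rw [hmg]; exact hε.holderBound h0 h1 hκ hξ rfl hx)
    (fun x x' hx => hε.holderBound hγ hγ' hκ' hζ rfl hx) h.T).map measurable_fst
  refine key.mono hα (le_of_eq ?_)
  rw [← ENNReal.ofReal_pow (Real.exp_pos _).le, ← ENNReal.ofReal_pow (Real.exp_pos _).le,
    ← ENNReal.ofReal_mul (by positivity), ← Real.exp_nat_mul, ← Real.exp_nat_mul, ← Real.exp_add]
  congr 2
  ring

end Algorithm

end PrivateDRO

theorem mainTheorem3 {Z : Type*} {d G : ℕ} [NeZero G] (n : Fin G → ℕ) (hn : ∀ g, 0 < n g)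
    (loss : Z → EuclideanSpace ℝ (Fin d) → ℝ) (hloss : ∀ z, Measurable (loss z))
    (init : Measure (EuclideanSpace ℝ (Fin d))) [IsProbabilityMeasure init]
    (h : PrivateDRO.Hyper) (hk : 0 < h.k) (hξ : 0 < h.ξ) (hσ : 0 < h.σ) (hζ : 0 < h.ζ)
    (hτ : 0 < h.τ) (hγ : 0 ≤ h.γ) (hγ' : h.γ ≤ 1)
    (α : ℝ) (hα : 1 < α) (ε : ℝ → ℝ → ℝ)
    -- `ε γ κ` is `ε_α(γ, κ)`, in either of its two meanings
    (hε : ε = PrivateDRO.sgmEps α ∨ ∃ a : ℕ, α = a ∧ ε = PrivateDRO.subsampledGaussEps a)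
    (M : ℕ) :
    -- aZB and aZB-weak
    ((∀ g, M ≤ n g) →
      PrivateDRO.IsGroupRDP α (PrivateDRO.aZB (n := n) h M loss init)
        (fun g => h.T * ε (M / n g) (h.σ / h.ξ) + (h.T / h.k : ℕ) * ε h.γ (h.τ / h.ζ)) ∧
      PrivateDRO.IsUniformRDP α (PrivateDRO.aZB (n := n) h M loss init)
        (h.T * ε (M / (⨅ g, n g : ℕ)) (h.σ / h.ξ) + (h.T / h.k : ℕ) * ε h.γ (h.τ / h.ζ)) ∧
      (⨆ g, (h.T * ε (M / n g) (h.σ / h.ξ) + (h.T / h.k : ℕ) * ε h.γ (h.τ / h.ζ))) =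
        h.T * ε (M / (⨅ g, n g : ℕ)) (h.σ / h.ξ) + (h.T / h.k : ℕ) * ε h.γ (h.τ / h.ζ)) ∧
    -- aZB-prop
    (M ≤ ∑ g, n g →
      PrivateDRO.IsUniformRDP α (PrivateDRO.aZBProp (n := n) h M loss init)
        (h.T * ε (M / (∑ g, n g : ℕ)) (h.σ / h.ξ) +
          (h.T / h.k : ℕ) * ε h.γ (h.τ / h.ζ))) := by
  have hamp : PrivateDRO.IsAmplificationBound α ε := by
    rcases hε with rfl | ⟨a, rfl, rfl⟩
    · exact PrivateDRO.isAmplificationBound_sgmEps hα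
    · exact PrivateDRO.isAmplificationBound_subsampledGaussEps hα
  have hκ : 0 < h.σ / h.ξ := by positivity
  have hn' : ∀ g, (0 : ℝ) < n g := fun g => by exact_mod_cast hn g
  refine ⟨fun hM => ?_, fun hM => ?_⟩
  · have hgroup : PrivateDRO.IsGroupRDP α (PrivateDRO.aZB (n := n) h M loss init)
        (fun g => h.T * ε (M / n g) (h.σ / h.ξ) +
          (h.T / h.k : ℕ) * ε h.γ (h.τ / h.ζ)) := by
      intro g
      have h1 : (M / n g : ℝ) ≤ 1 := by
        rw [div_le_one (hn' g)]
        exact_mod_cast hM g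
      refine PrivateDRO.isRDP_groupDRO hα hamp hloss hξ hσ hζ hτ hγ hγ' hM (by positivity) h1 g ?_
      rw [div_mul_cancel₀ _ (hn' g).ne', Nat.floor_natCast]
    -- A smallest group has the largest sampling rate; by monotonicity in the rate it attains the
    -- maximum.
    obtain ⟨g₀, hg₀⟩ := exists_eq_ciInf_of_finite (f := n)
    have hle : ∀ g, h.T * ε (M / n g) (h.σ / h.ξ) + (h.T / h.k : ℕ) * ε h.γ (h.τ / h.ζ) ≤
        h.T * ε (M / (⨅ g, n g : ℕ)) (h.σ / h.ξ) +
          (h.T / h.k : ℕ) * ε h.γ (h.τ / h.ζ) := by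
      intro g
      rw [← hg₀]
      have hmin : n g₀ ≤ n g := by rw [hg₀]; exact ciInf_le (OrderBot.bddBelow _) g
      have h0 : (0 : ℝ) < n g₀ := hn' g₀
      have h1 : (M / n g₀ : ℝ) ≤ 1 := by
        rw [div_le_one h0]
        exact_mod_cast hM g₀
      have h2 : (M / n g : ℝ) ≤ M / n g₀ := by gcongr
      have := hamp.mono (by positivity) h2 h1 hκ
      gcongr
    refine ⟨hgroup, ⟨(hgroup g₀).1, ?_⟩, le_antisymm (ciSup_le hle) ?_⟩
    · rintro D D' ⟨g, hD⟩
      exact ((hgroup g).2 D D' hD).trans (EReal.coe_le_coe_iff.2 (hle g))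
    · refine le_ciSup_of_le (Set.finite_range _).bddAbove g₀ (le_of_eq ?_)
      rw [hg₀]
  · have g₀ : Fin G := 0
    have hpos : 0 < ∑ g, n g :=
      Finset.sum_pos (fun g _ => hn g) ⟨g₀, Finset.mem_univ _⟩
    have hpos' : (0 : ℝ) < (∑ g, n g : ℕ) := by exact_mod_cast hpos
    have h1 : (M / (∑ g, n g : ℕ) : ℝ) ≤ 1 := by
      rw [div_le_one hpos']
      exact_mod_cast hM
    have hm : ∀ g, M * n g / ∑ g', n g' ≤ n g := fun g =>
      Nat.div_le_of_le_mul (Nat.mul_le_mul_right _ hM)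
    have hgroup := fun g => PrivateDRO.isRDP_groupDRO (init := init) hα hamp hloss hξ hσ hζ hτ
      hγ hγ' hm (by positivity) h1 g (by
        -- The batch size, a quotient in `ℕ`, is `⌊(M / ∑ g, n g) * n g⌋`: the same rate for every
        -- group.
        rw [div_mul_eq_mul_div, ← Nat.cast_mul, Nat.floor_div_eq_div])
    exact ⟨(hgroup g₀).1, fun D D' ⟨g, hD⟩ => (hgroup g).2 D D' hD⟩
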